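/- **Conventions.** $\mathbb H$ is the skew field of real quaternions; $\mathbf A^*$ is the conjugate transpose; $\operatorname{rk}$ is the rank of a quaternion matrix (the dimension of its right column space); $\operatorname{Ind}\mathbf V$ is the smallest positive integer $k$ with $\operatorname{rk}\mathbf V^{k+1}=\operatorname{rk}\mathbf V^{k}$. For $\mathbf A\in\mathbb H^{m\times n}$ and $\mathbf W\in\mathbb H^{n\times m}$, $\mathbf A^\dagger$ is the Moore–Penrose inverse of $\mathbf A$ (the unique $\mathbf X$ with $\mathbf A\mathbf X\mathbf A=\mathbf A$, $\mathbf X\mathbf A\mathbf X=\mathbf X$, $(\mathbf A\mathbf X)^*=\mathbf A\mathbf X$, $(\mathbf X\mathbf A)^*=\mathbf X\mathbf A$), and $\mathbf A^{d,W}$ is the $W$-weighted Drazin inverse (the unique $\mathbf X$ with $(\mathbf A\mathbf W)^{p+1}\mathbf X\mathbf W=(\mathbf A\mathbf W)^{p}$, $\mathbf X\mathbf W\mathbf A\mathbf W\mathbf X=\mathbf X$, $\mathbf A\mathbf W\mathbf X=\mathbf X\mathbf W\mathbf A$, where $p=\operatorname{Ind}(\mathbf A\mathbf W)$). The $W$-weighted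 MPD inverse of $\mathbf A$ is $\mathbf A^{\dagger,d,W}=\mathbf A^\dagger\mathbf A\mathbf W\mathbf A^{d,W}\mathbf W\in\mathbb H^{n\times m}$. For a quaternion matrix $\mathbf B=(b_{pq})$ with rows and columns indexed by a finite linearly ordered set of $N$ elements, and an index $j$, the $j$-th column determinant $\operatorname{cdet}_j\mathbf B$ is the sum over all permutations $\sigma$ of the indices of $(-1)^{N-c}$ ($c$ being the number of cycles of $\sigma$, fixed points included) times the ordered product of the cycle factors $b_{i\,\sigma^{l}(i)}\cdots b_{\sigma^2(i)\,\sigma(i)}\,b_{\sigma(i)\,i}$, one for each cycle ($l+1$ being its length), where the cycle through $j$ stands rightmost and is written with $i=j$, every other cycle is written with $i$ its least element, and these least elements increase from right to left. If $\mathbf B$ is Hermitian, all $\operatorname{cdet}_j\mathbf B$ coincide, and $|\mathbf B|$ denotes their common value (the empty determinant is $1$). $J_{r,n}$ is the set of $r$-element subsets of $\{1,\dots,n\}$ and $J_{r,n}\{i\}$ the set of those containing $i$; $\mathbf M_\beta^\beta$ is the principal submatrix with rows and columns in $\beta$ (with the original labels of its rows and columns) and $|\mathbf M|_\beta^\beta$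 its determinant when $\mathbf M$ is Hermitian; $\mathbf M_{.i}(\mathbf b)$ is $\mathbf M$ with its $i$-th column replaced by $\mathbf b$. **Theorem.** Let $\mathbf A\in\mathbb H^{m\times n}$ with $\operatorname{rk}\mathbf A=r$, let $\mathbf W\in\mathbb H^{n\times m}$ be nonzero, and put $\mathbf V=\mathbf A\mathbf W$, $k=\max\{\operatorname{Ind}(\mathbf W\mathbf A),\operatorname{Ind}(\mathbf A\mathbf W)\}$ and $r_1=\operatorname{rk}(\mathbf A\mathbf W)^k$. Then the entries of $\mathbf A^{\dagger,d,W}=(a^{\dagger,d,W}_{ij})$ are given as follows. (i) For arbitrary $\mathbf A\mathbf W$, $$a^{\dagger,d,W}_{ij}=\frac{\sum_{\beta\in J_{r,n}\{i\}}\operatorname{cdet}_i\big((\mathbf A^*\mathbf A)_{.i}(\widetilde{\boldsymbol\upsilon}_{.j})\big)_\beta^\beta}{\sum_{\beta\in J_{r,n}}|\mathbf A^*\mathbf A|_\beta^\beta\,\Big(\sum_{\beta\in J_{r_1,m}}\big|(\mathbf V^{2k+1})^*\mathbf V^{2k+1}\big|_\beta^\beta\Big)^2},$$ where $\widetilde{\boldsymbol\upsilon}_{.j}$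 is the $j$-th column of $\widetilde{\boldsymbol\Upsilon}=\mathbf A^*(\mathbf A\mathbf W)^{k+1}\boldsymbol\Upsilon$, the matrix $\boldsymbol\Upsilon=(\upsilon_{tj})\in\mathbb H^{m\times m}$ is $$\upsilon_{tj}=\sum_{\beta\in J_{r_1,m}\{t\}}\operatorname{cdet}_t\Big(\big((\mathbf V^{2k+1})^*\mathbf V^{2k+1}\big)_{.t}(\widehat{\boldsymbol\psi}_{.j})\Big)_\beta^\beta,$$ $\widehat{\boldsymbol\psi}_{.j}$ is the $j$-th column of $\widehat{\boldsymbol\Psi}=(\mathbf V^{2k+1})^*\mathbf V^{2k}\boldsymbol\Psi\mathbf A\mathbf W\in\mathbb H^{m\times m}$, the matrix $\boldsymbol\Psi=(\psi_{sl})\in\mathbb H^{m\times m}$ is $$\psi_{sl}=\sum_{\beta\in J_{r_1,m}\{s\}}\operatorname{cdet}_s\Big(\big((\mathbf V^{2k+1})^*\mathbf V^{2k+1}\big)_{.s}(\hat{\mathbf v}_{.l})\Big)_\beta^\beta,$$ and $\hat{\mathbf v}_{.l}$ is the $l$-th column of $(\mathbf V^{2k+1})^*\mathbf V^{k}$. (ii)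 If $\mathbf A\mathbf W$ is Hermitian, then also $$a^{\dagger,d,W}_{ij}=\frac{\sum_{\beta\in J_{r,n}\{i\}}\operatorname{cdet}_i\big((\mathbf A^*\mathbf A)_{.i}(\widetilde{\boldsymbol\upsilon}_{.j})\big)_\beta^\beta}{\sum_{\beta\in J_{r,n}}|\mathbf A^*\mathbf A|_\beta^\beta\;\sum_{\beta\in J_{r_1,m}}\big|(\mathbf A\mathbf W)^{k+2}\big|_\beta^\beta},$$ where $\widetilde{\boldsymbol\upsilon}_{.j}$ is the $j$-th column of $\widetilde{\boldsymbol\Upsilon}=\mathbf A^*\mathbf A\mathbf W\boldsymbol\Upsilon$, the matrix $\boldsymbol\Upsilon=(\upsilon_{sj})\in\mathbb H^{m\times m}$ is $$\upsilon_{sj}=\sum_{\beta\in J_{r_1,m}\{s\}}\operatorname{cdet}_s\big((\mathbf A\mathbf W)^{k+2}_{.s}(\widetilde{\mathbf v}_{.j})\big)_\beta^\beta,$$ and $\widetilde{\mathbf v}_{.j}$ is the $j$-th column of $(\mathbf A\mathbf W)^{k+1}$. -/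

import Mathlib

open scoped Quaternion Matrix

namespace QMat

/-! ### Rank, index and generalized inverses of quaternion matrices -/

/-- The rank of a quaternion matrix: the dimension of its right column space, that is, of the
right `ℍ`-span of its columns (right scalar multiplication is the action of `ℍᵐᵒᵖ`). -/
noncomputable def rank {m n : ℕ} (A : Matrix (Fin m) (Fin n) ℍ[ℝ]) : ℕ :=
  Module.finrank (ℍ[ℝ])ᵐᵒᵖ (Submodule.span (ℍ[ℝ])ᵐᵒᵖ (Set.range Aᵀ))

/-- The index of a square quaternion matrix: the smallest positive `k` with
`rank (V ^ (k + 1)) = rank (V ^ k)` (such a `k` exists, see `index_spec`). -/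
noncomputable def index {n : ℕ} (V : Matrix (Fin n) (Fin n) ℍ[ℝ]) : ℕ :=
  sInf {k : ℕ | 0 < k ∧ rank (V ^ (k + 1)) = rank (V ^ k)}

/-- The four Penrose equations. -/
structure IsMoorePenrose {m n : ℕ} (A : Matrix (Fin m) (Fin n) ℍ[ℝ])
    (X : Matrix (Fin n) (Fin m) ℍ[ℝ]) : Prop where
  mul_mul_left : A * X * A = A
  mul_mul_right : X * A * X = X
  left_hermitian : (A * X)ᴴ = A * X
  right_hermitian : (X * A)ᴴ = X * A

/-- The equations of the `W`-weighted Drazin inverse of `A`. -/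
structure IsWeightedDrazin {m n : ℕ} (A : Matrix (Fin m) (Fin n) ℍ[ℝ])
    (W : Matrix (Fin n) (Fin m) ℍ[ℝ]) (X : Matrix (Fin m) (Fin n) ℍ[ℝ]) : Prop where
  pow_mul : (A * W) ^ (index (A * W) + 1) * X * W = (A * W) ^ index (A * W)
  mul_mul : X * W * A * W * X = X
  comm : A * W * X = X * W * A

/-! ### Existence and uniqueness of these inverses -/

theorem exists_mul_of_span_le {m n p : ℕ} {A : Matrix (Fin m) (Fin n) ℍ[ℝ]}
    {B : Matrix (Fin m) (Fin p) ℍ[ℝ]}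
    (h : Submodule.span (ℍ[ℝ])ᵐᵒᵖ (Set.range Aᵀ) ≤ Submodule.span (ℍ[ℝ])ᵐᵒᵖ (Set.range Bᵀ)) :
    ∃ Z : Matrix (Fin p) (Fin n) ℍ[ℝ], A = B * Z := by
  have h1 : ∀ j, ∃ c : Fin p → (ℍ[ℝ])ᵐᵒᵖ, ∑ l, c l • Bᵀ l = Aᵀ j := fun j =>
    (Submodule.mem_span_range_iff_exists_fun _).1 (h (Submodule.subset_span ⟨j, rfl⟩))
  choose c hc using h1
  refine ⟨Matrix.of fun l j => (c j l).unop, ?_⟩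
  ext1 i j
  have := congrFun (hc j) i
  simpa [Matrix.mul_apply, Finset.sum_apply] using this.symm

theorem span_mul_le {m n p : ℕ} (B : Matrix (Fin m) (Fin p) ℍ[ℝ])
    (Z : Matrix (Fin p) (Fin n) ℍ[ℝ]) :
    Submodule.span (ℍ[ℝ])ᵐᵒᵖ (Set.range (B * Z)ᵀ) ≤
      Submodule.span (ℍ[ℝ])ᵐᵒᵖ (Set.range Bᵀ) := by
  rw [Submodule.span_le]
  rintro _ ⟨j, rfl⟩
  refine (Submodule.mem_span_range_iff_exists_fun _).2 ⟨fun l => MulOpposite.op (Z l j), ?_⟩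
  ext1 i
  simp [Matrix.mul_apply, Finset.sum_apply]

instance : Module.Finite (ℍ[ℝ])ᵐᵒᵖ ℍ[ℝ] :=
  Module.Finite.of_surjective
    ({ toFun := fun x => x.unop
       map_add' := fun _ _ => rfl
       map_smul' := fun _ _ => rfl } : (ℍ[ℝ])ᵐᵒᵖ →ₗ[(ℍ[ℝ])ᵐᵒᵖ] ℍ[ℝ])
    MulOpposite.unop_surjective

theorem rank_mul_le {m n p : ℕ} (B : Matrix (Fin m) (Fin p) ℍ[ℝ])
    (Z : Matrix (Fin p) (Fin n) ℍ[ℝ]) : rank (B * Z) ≤ rank B :=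
  Submodule.finrank_mono (span_mul_le B Z)

theorem exists_mul_of_rank_eq {m n p : ℕ} (B : Matrix (Fin m) (Fin p) ℍ[ℝ])
    (Z : Matrix (Fin p) (Fin n) ℍ[ℝ]) (h : rank (B * Z) = rank B) :
    ∃ Y : Matrix (Fin n) (Fin p) ℍ[ℝ], B = B * Z * Y :=
  exists_mul_of_span_le (Submodule.eq_of_le_of_finrank_eq (span_mul_le B Z) h).ge

theorem index_spec {n : ℕ} (V : Matrix (Fin n) (Fin n) ℍ[ℝ]) :
    0 < index V ∧ rank (V ^ (index V + 1)) = rank (V ^ index V) := by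
  have hne : {k : ℕ | 0 < k ∧ rank (V ^ (k + 1)) = rank (V ^ k)}.Nonempty := by
    by_contra hcon
    have hlt : ∀ k, rank (V ^ (k + 2)) < rank (V ^ (k + 1)) := fun k => by
      refine lt_of_le_of_ne (by rw [pow_succ V (k + 1)]; exact rank_mul_le _ _) fun he => ?_
      exact hcon ⟨k + 1, Nat.succ_pos k, he⟩
    have hb : ∀ k, rank (V ^ (k + 1)) + k ≤ rank (V ^ 1) := fun k => by
      induction k with
      | zero => simp
      | succ k ih => have := hlt k; rw [show k + 1 + 1 = k + 2 from rfl]; omega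
    have := hb (rank (V ^ 1) + 1)
    omega
  exact Nat.sInf_mem hne

theorem exists_pow_eq_pow_succ_mul {n : ℕ} (V : Matrix (Fin n) (Fin n) ℍ[ℝ]) :
    ∃ Z : Matrix (Fin n) (Fin n) ℍ[ℝ], V ^ index V = V ^ (index V + 1) * Z := by
  have h := (index_spec V).2
  rw [pow_succ] at h ⊢
  exact exists_mul_of_rank_eq _ _ h

theorem pow_eq_pow_add_mul_pow {R : Type*} [Ring R] {v z : R} {a : ℕ} (h : v ^ a = v ^ (a + 1) * z)
    (j : ℕ) : v ^ a = v ^ (a + j) * z ^ j := by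
  induction j with
  | zero => simp
  | succ j ih =>
    have h2 : v ^ (a + j) = v ^ (a + (j + 1)) * z := by
      rw [add_comm a j, pow_add, h, ← mul_assoc, ← pow_add]; congr 2; omega
    calc v ^ a = v ^ (a + j) * z ^ j := ih
      _ = v ^ (a + (j + 1)) * z * z ^ j := by rw [← h2]
      _ = v ^ (a + (j + 1)) * z ^ (j + 1) := by rw [mul_assoc, ← pow_succ']

theorem pow_eq_pow_mul_pow_add {R : Type*} [Ring R] {v z : R} {a : ℕ} (h : v ^ a = z * v ^ (a + 1))
    (j : ℕ) : v ^ a = z ^ j * v ^ (a + j) := by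
  induction j with
  | zero => simp
  | succ j ih =>
    have h2 : v ^ (a + j) = z * v ^ (a + (j + 1)) := by
      rw [pow_add, h, mul_assoc, ← pow_add]; congr 2; omega
    calc v ^ a = z ^ j * v ^ (a + j) := ih
      _ = z ^ j * (z * v ^ (a + (j + 1))) := by rw [← h2]
      _ = z ^ (j + 1) * v ^ (a + (j + 1)) := by rw [← mul_assoc, ← pow_succ]

theorem exists_drazin_of_ring {R : Type*} [Ring R] {v y z : R} {a b : ℕ}
    (hz : v ^ a = v ^ (a + 1) * z) (hy : v ^ b = y * v ^ (b + 1)) :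
    ∃ d, v ^ (a + 1) * d = v ^ a ∧ d * v * d = d ∧ v * d = d * v := by
  -- a common exponent `N`
  obtain ⟨N, hzN, hyN⟩ : ∃ N, v ^ N = v ^ (N + 1) * z ∧ v ^ N = y * v ^ (N + 1) := by
    refine ⟨a + b, ?_, ?_⟩
    · rw [add_comm a b, pow_add, hz, ← mul_assoc, ← pow_add]; rfl
    · rw [add_comm a b, pow_add, hy, mul_assoc, ← pow_add]; congr 2; omega
  have h1 := pow_eq_pow_add_mul_pow hzN
  have h2 := pow_eq_pow_mul_pow_add hyN
  -- `d = v ^ N * z ^ (N + 1) = y ^ (N + 1) * v ^ N`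
  have hd : v ^ N * z ^ (N + 1) = y ^ (N + 1) * v ^ N := by
    calc v ^ N * z ^ (N + 1) = y ^ (N + 1) * v ^ (N + (N + 1)) * z ^ (N + 1) := by
          rw [← h2]
      _ = y ^ (N + 1) * v ^ N := by rw [mul_assoc, ← h1]
  have e1 : v * (v ^ N * z ^ (N + 1)) = v ^ N * z ^ N := by
    rw [← mul_assoc, ← pow_succ', pow_succ' z, ← mul_assoc, ← hzN]
  have e2 : y ^ (N + 1) * v ^ N * v = y ^ N * v ^ N := by
    rw [mul_assoc, ← pow_succ, pow_succ y, mul_assoc, ← hyN]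
  have e3 : v ^ N * z ^ N = y ^ N * v ^ N := by
    calc v ^ N * z ^ N = y ^ N * v ^ (N + N) * z ^ N := by rw [← h2]
      _ = y ^ N * v ^ N := by rw [mul_assoc, ← h1]
  have hcomm : v * (v ^ N * z ^ (N + 1)) = v ^ N * z ^ (N + 1) * v := by
    rw [e1, e3, ← e2, ← hd]
  have hN : v ^ N * (v ^ N * z ^ N) = v ^ N := by
    rw [← mul_assoc, ← pow_add, ← h1]
  refine ⟨v ^ N * z ^ (N + 1), ?_, ?_, hcomm⟩
  · -- `v ^ a` is `v ^ (a + N)` times a power of `z`, and `v * d` commutes with `v`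
    have hc : Commute (v * (v ^ N * z ^ (N + 1))) v := by
      have hc0 : Commute v (v ^ N * z ^ (N + 1)) := hcomm
      exact ((Commute.refl v).mul_right hc0).symm
    have h3 := pow_eq_pow_add_mul_pow hz N
    have h4 : v * (v ^ N * z ^ (N + 1)) * v ^ N = v ^ N := by
      rw [(hc.pow_right N).eq, e1, hN]
    rw [pow_succ, mul_assoc, ← (hc.pow_right a).eq]
    calc v * (v ^ N * z ^ (N + 1)) * v ^ a
        = v * (v ^ N * z ^ (N + 1)) * (v ^ (N + a) * z ^ N) := by
          rw [add_comm N a, ← h3]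
      _ = v * (v ^ N * z ^ (N + 1)) * v ^ N * (v ^ a * z ^ N) := by
          rw [pow_add v N a, mul_assoc (v * (v ^ N * z ^ (N + 1))) (v ^ N), mul_assoc (v ^ N)]
      _ = v ^ a := by rw [h4, ← mul_assoc, ← pow_add, add_comm N a, ← h3]
  · rw [← hcomm, e1, e3, mul_assoc]
    rw [← mul_assoc (v ^ N), ← pow_add]
    calc y ^ N * (v ^ (N + N) * z ^ (N + 1)) = y ^ N * v ^ (N + N) * z ^ (N + 1) := by
          rw [mul_assoc]
      _ = v ^ N * z ^ (N + 1) := by rw [← h2]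

theorem drazin_unique_of_ring {R : Type*} [Ring R] {v x y : R} {k : ℕ}
    (hx1 : v ^ (k + 1) * x = v ^ k) (hx2 : Commute v x) (hx3 : x * v * x = x)
    (hy1 : v ^ (k + 1) * y = v ^ k) (hy2 : Commute v y) (hy3 : y * v * y = y) : x = y := by
  have key : ∀ {x y : R}, Commute v x → x * v * x = x → v ^ (k + 1) * y = v ^ k → Commute v y →
      v * x = v * x * (v * y) ∧ v * x = v * y * (v * x) := by
    intro x y hx2 hx3 hy1 hy2
    have hi : IsIdempotentElem (v * x) := by
      change v * x * (v * x) = v * x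
      rw [mul_assoc, ← mul_assoc x, hx3]
    have hp : v * x = v ^ (k + 1) * x ^ (k + 1) := by
      rw [← hx2.mul_pow, hi.pow_succ_eq]
    have hp' : v * x = x ^ (k + 1) * v ^ (k + 1) := by
      rw [hp, (hx2.pow_pow _ _).eq]
    have h1 : v ^ (k + 1) * (v * y) = v ^ (k + 1) := by
      rw [hy2.eq, ← mul_assoc, hy1, ← pow_succ]
    have h2 : v * y * v ^ (k + 1) = v ^ (k + 1) := by
      have : Commute (v * y) v := ((Commute.refl v).mul_right hy2).symm
      rw [(this.pow_right _).eq, h1]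
    constructor
    · rw [hp', mul_assoc, h1]
    · rw [hp, ← mul_assoc, h2]
  have hxy : v * x = v * y := (key hx2 hx3 hy1 hy2).1.trans (key hy2 hy3 hx1 hx2).2.symm
  calc x = x * (v * x) := by rw [← mul_assoc, hx3]
    _ = x * v * y := by rw [hxy, mul_assoc]
    _ = y * v * y := by rw [← hx2.eq, hxy, hy2.eq]
    _ = y := hy3

/-- Every square quaternion matrix has a Drazin inverse. -/
theorem exists_drazin {n : ℕ} (V : Matrix (Fin n) (Fin n) ℍ[ℝ]) :
    ∃ D : Matrix (Fin n) (Fin n) ℍ[ℝ],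
      V ^ (index V + 1) * D = V ^ index V ∧ D * V * D = D ∧ V * D = D * V := by
  obtain ⟨Z, hZ⟩ := exists_pow_eq_pow_succ_mul V
  obtain ⟨Y, hY⟩ := exists_pow_eq_pow_succ_mul Vᴴ
  refine exists_drazin_of_ring hZ (y := Yᴴ) (b := index Vᴴ) ?_
  have := congrArg Matrix.conjTranspose hY
  simpa only [Matrix.conjTranspose_mul, ← Matrix.conjTranspose_pow,
    Matrix.conjTranspose_conjTranspose] using this

theorem exists_isWeightedDrazin {m n : ℕ} (A : Matrix (Fin m) (Fin n) ℍ[ℝ])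
    (W : Matrix (Fin n) (Fin m) ℍ[ℝ]) : ∃ X, IsWeightedDrazin A W X := by
  obtain ⟨D, h1, h2, h3⟩ := exists_drazin (A * W)
  have h4 : D * D * (A * W) = D := by rw [mul_assoc, ← h3, ← mul_assoc, h2]
  have h4' : D * D * A * W = D := by rw [Matrix.mul_assoc, h4]
  refine ⟨D * D * A, ?_, ?_, ?_⟩
  · rw [Matrix.mul_assoc, h4', h1]
  · rw [h4', Matrix.mul_assoc D A W, ← Matrix.mul_assoc, ← Matrix.mul_assoc, h2]
  · rw [h4', ← Matrix.mul_assoc, ← Matrix.mul_assoc, h3, h2]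

theorem IsWeightedDrazin.unique {m n : ℕ} {A : Matrix (Fin m) (Fin n) ℍ[ℝ]}
    {W : Matrix (Fin n) (Fin m) ℍ[ℝ]} {X Y : Matrix (Fin m) (Fin n) ℍ[ℝ]}
    (hX : IsWeightedDrazin A W X) (hY : IsWeightedDrazin A W Y) : X = Y := by
  -- `X * W` and `Y * W` are both the Drazin inverse of `A * W`
  have key : ∀ {X : Matrix (Fin m) (Fin n) ℍ[ℝ]}, IsWeightedDrazin A W X →
      (A * W) ^ (index (A * W) + 1) * (X * W) = (A * W) ^ index (A * W) ∧
      Commute (A * W) (X * W) ∧ X * W * (A * W) * (X * W) = X * W ∧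
      X = X * W * (X * W) * A := by
    intro X h
    have hc : A * W * (X * W) = X * W * (A * W) := by
      rw [← Matrix.mul_assoc, h.comm, Matrix.mul_assoc (X * W)]
    refine ⟨by rw [← Matrix.mul_assoc, h.pow_mul], hc, ?_, ?_⟩
    · rw [← Matrix.mul_assoc (X * W) A W, ← Matrix.mul_assoc _ X W, h.mul_mul]
    · conv_lhs => rw [← h.mul_mul, Matrix.mul_assoc (X * W), Matrix.mul_assoc (X * W), h.comm,
        ← Matrix.mul_assoc]
  obtain ⟨a1, a2, a3, a4⟩ := key hX
  obtain ⟨b1, b2, b3, b4⟩ := key hY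
  have hXY : X * W = Y * W := by
    exact drazin_unique_of_ring a1 a2 a3 b1 b2 b3
  rw [a4, b4, hXY]

theorem eq_zero_of_conjTranspose_mul_self {m n : ℕ} {B : Matrix (Fin m) (Fin n) ℍ[ℝ]}
    (h : Bᴴ * B = 0) : B = 0 := by
  ext1 i j
  have h1 : ∑ l, star (B l j) * B l j = 0 := by
    simpa [Matrix.mul_apply] using congrFun (congrFun h j) j
  have h2 : ∑ l, Quaternion.normSq (B l j) = 0 := by
    apply (algebraMap ℝ ℍ[ℝ]).injective
    rw [map_sum, map_zero, ← h1]
    exact Finset.sum_congr rfl fun l _ => (Quaternion.star_mul_self _).symm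
  have h3 := (Finset.sum_eq_zero_iff_of_nonneg fun l _ => Quaternion.normSq_nonneg).1 h2 i
    (Finset.mem_univ i)
  exact Quaternion.normSq_eq_zero.1 h3

theorem mul_eq_zero_of_conjTranspose_mul {m n p : ℕ} {B : Matrix (Fin m) (Fin n) ℍ[ℝ]}
    {M : Matrix (Fin n) (Fin p) ℍ[ℝ]} (h : Bᴴ * (B * M) = 0) : B * M = 0 := by
  apply eq_zero_of_conjTranspose_mul_self
  rw [Matrix.conjTranspose_mul, Matrix.mul_assoc, h, Matrix.mul_zero]

theorem exists_mul_conjTranspose_mul_self {m n : ℕ} (A : Matrix (Fin m) (Fin n) ℍ[ℝ]) :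
    ∃ Z : Matrix (Fin m) (Fin n) ℍ[ℝ], A = A * Aᴴ * Z := by
  obtain ⟨G, hG⟩ : ∃ G, G = A * Aᴴ := ⟨_, rfl⟩
  have hGs : Gᴴ = G := by rw [hG, Matrix.conjTranspose_mul, Matrix.conjTranspose_conjTranspose]
  obtain ⟨D, h1, -, h3⟩ := exists_drazin G
  have hpow : ∀ k : ℕ, G ^ (k + 1) * (1 - G * D) = 0 → G * (1 - G * D) = 0 := by
    intro k
    induction k with
    | zero => intro h; simpa using h
    | succ k ih =>
      intro h
      refine ih ?_
      rw [pow_succ', Matrix.mul_assoc]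
      apply mul_eq_zero_of_conjTranspose_mul
      rw [hGs, ← Matrix.mul_assoc, ← Matrix.mul_assoc, mul_assoc G, ← pow_succ', ← pow_succ', h]
  have h4 : G * (1 - G * D) = 0 := by
    apply hpow (index G)
    rw [mul_sub, mul_one, pow_succ', mul_assoc, ← mul_assoc (G ^ _), ← pow_succ, h1, sub_self]
  have h5 : Aᴴ * (1 - G * D) = 0 := by
    apply mul_eq_zero_of_conjTranspose_mul
    rw [Matrix.conjTranspose_conjTranspose, ← Matrix.mul_assoc, ← hG, h4]
  have h6 := congrArg Matrix.conjTranspose h5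
  rw [h3, Matrix.conjTranspose_mul, Matrix.conjTranspose_conjTranspose, Matrix.conjTranspose_sub,
    Matrix.conjTranspose_one, Matrix.conjTranspose_mul, hGs, Matrix.conjTranspose_zero,
    Matrix.sub_mul, Matrix.one_mul, sub_eq_zero] at h6
  exact ⟨Dᴴ * A, by rw [← hG, ← Matrix.mul_assoc]; exact h6⟩

theorem exists_isMoorePenrose {m n : ℕ} (A : Matrix (Fin m) (Fin n) ℍ[ℝ]) :
    ∃ X, IsMoorePenrose A X := by
  obtain ⟨Z, hZ⟩ := exists_mul_conjTranspose_mul_self A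
  obtain ⟨Y, hY⟩ := exists_mul_conjTranspose_mul_self Aᴴ
  rw [Matrix.conjTranspose_conjTranspose] at hY
  -- `P = Aᴴ * Z` and `Q = A * Y` are the two orthogonal projectors
  have hP : (Aᴴ * Z)ᴴ = Aᴴ * Z := by
    have : Aᴴ * Z = (Aᴴ * Z)ᴴ * (Aᴴ * Z) := by
      conv_lhs => rw [hZ]
      simp only [Matrix.conjTranspose_mul, Matrix.conjTranspose_conjTranspose, Matrix.mul_assoc]
    rw [this]
    simp only [Matrix.conjTranspose_mul, Matrix.conjTranspose_conjTranspose]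
  have hQ : (A * Y)ᴴ = A * Y := by
    have : A * Y = (A * Y)ᴴ * (A * Y) := by
      conv_lhs => rw [← Matrix.conjTranspose_conjTranspose A, hY]
      simp only [Matrix.conjTranspose_mul, Matrix.conjTranspose_conjTranspose, Matrix.mul_assoc]
    rw [this]
    simp only [Matrix.conjTranspose_mul, Matrix.conjTranspose_conjTranspose]
  have hAP : A * (Aᴴ * Z) = A := by rw [← Matrix.mul_assoc, ← hZ]
  have hP' : Zᴴ * A = Aᴴ * Z := by
    rw [← hP, Matrix.conjTranspose_mul, Matrix.conjTranspose_conjTranspose]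
  have hQA : A * Y * A = A := by
    have := congrArg Matrix.conjTranspose hY
    rwa [Matrix.conjTranspose_mul, Matrix.conjTranspose_mul, Matrix.conjTranspose_conjTranspose,
      ← Matrix.mul_assoc, ← Matrix.conjTranspose_conjTranspose A, ← Matrix.conjTranspose_mul,
      Matrix.conjTranspose_conjTranspose, hQ, eq_comm] at this
  have hAX : A * (Zᴴ * A * Y) = A * Y := by rw [hP', ← Matrix.mul_assoc, hAP]
  have hXA : Zᴴ * A * Y * A = Aᴴ * Z := by
    rw [Matrix.mul_assoc, Matrix.mul_assoc, ← Matrix.mul_assoc A, hQA, hP']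
  refine ⟨Zᴴ * A * Y, ?_, ?_, ?_, ?_⟩
  · rw [hAX, hQA]
  · rw [hXA, ← hP', Matrix.mul_assoc, hAX, ← Matrix.mul_assoc]
  · rw [hAX, hQ]
  · rw [hXA, hP]

theorem IsMoorePenrose.unique {m n : ℕ} {A : Matrix (Fin m) (Fin n) ℍ[ℝ]}
    {X Y : Matrix (Fin n) (Fin m) ℍ[ℝ]}
    (hX : IsMoorePenrose A X) (hY : IsMoorePenrose A Y) : X = Y := by
  have h1 : A * X = A * Y := by
    calc A * X = (A * X)ᴴ := hX.left_hermitian.symm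
      _ = ((A * Y) * (A * X))ᴴ := by rw [← Matrix.mul_assoc, hY.mul_mul_left]
      _ = A * X * (A * Y) := by
          rw [Matrix.conjTranspose_mul, hX.left_hermitian, hY.left_hermitian]
      _ = A * Y := by rw [← Matrix.mul_assoc, hX.mul_mul_left]
  have h2 : X * A = Y * A := by
    calc X * A = (X * A)ᴴ := hX.right_hermitian.symm
      _ = ((X * A) * (Y * A))ᴴ := by
          rw [Matrix.mul_assoc, ← Matrix.mul_assoc A, hY.mul_mul_left]
      _ = Y * A * (X * A) := by
          rw [Matrix.conjTranspose_mul, hX.right_hermitian, hY.right_hermitian]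
      _ = Y * A := by rw [Matrix.mul_assoc, ← Matrix.mul_assoc A, hX.mul_mul_left]
  rw [← hX.mul_mul_right, h2, Matrix.mul_assoc, h1, ← Matrix.mul_assoc, hY.mul_mul_right]

/-- The Moore-Penrose inverse `A^†`, the unique solution of the Penrose equations. -/
noncomputable def mpInv {m n : ℕ} (A : Matrix (Fin m) (Fin n) ℍ[ℝ]) :
    Matrix (Fin n) (Fin m) ℍ[ℝ] :=
  (exists_isMoorePenrose A).choose

/-- The `W`-weighted Drazin inverse `A^{d,W}`, the unique solution of its defining equations. -/
noncomputable def wDrazinInv {m n : ℕ} (A : Matrix (Fin m) (Fin n) ℍ[ℝ])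
    (W : Matrix (Fin n) (Fin m) ℍ[ℝ]) : Matrix (Fin m) (Fin n) ℍ[ℝ] :=
  (exists_isWeightedDrazin A W).choose

/-- The `W`-weighted MPD inverse `A^{†,d,W} = A^† A W A^{d,W} W`. -/
noncomputable def wmpdInv {m n : ℕ} (A : Matrix (Fin m) (Fin n) ℍ[ℝ])
    (W : Matrix (Fin n) (Fin m) ℍ[ℝ]) : Matrix (Fin n) (Fin m) ℍ[ℝ] :=
  mpInv A * A * W * wDrazinInv A W * W

/-! ### Column determinants -/

section Cdet

variable {ι : Type*} [Fintype ι] [LinearOrder ι]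

/-- The factor of a column determinant that belongs to the cycle of `σ` through `c`, written from
right to left starting at `c`: `a (c, σ^l c) ⋯ a (σ² c, σ c) a (σ c, c)`, where `l + 1` is the
length of the cycle (for a fixed point it is `a (c, c)`). -/
noncomputable def cycleFactor (A : Matrix ι ι ℍ[ℝ]) (σ : Equiv.Perm ι) (c : ι) : ℍ[ℝ] :=
  ((List.range (Function.minimalPeriod σ c)).map
    fun t => A ((σ ^ (t + 1)) c) ((σ ^ t) c)).reverse.prod

open Classical in
/-- The least elements of the cycles of `σ` (fixed points included) not passing through `j`, listed
in decreasing order. -/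
noncomputable def cycleHeads (σ : Equiv.Perm ι) (j : ι) : List ι :=
  (Finset.univ.filter fun c => ¬ σ.SameCycle j c ∧ ∀ d, σ.SameCycle c d → c ≤ d).sort (· ≥ ·)

/-- The `j`-th column determinant of a quaternion matrix. In the term of `σ` the cycle through `j`
stands rightmost and starts (from the right) with `j`; each other cycle starts from the right with
its least element, and these least elements increase from right to left. With `r` cycles in all,
fixed points included, the sign `(-1)^(n-r)` is the sign of `σ`. -/
noncomputable def cdet (A : Matrix ι ι ℍ[ℝ]) (j : ι) : ℍ[ℝ] :=
  ∑ σ : Equiv.Perm ι, Equiv.Perm.sign σ •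
    (((cycleHeads σ j).map (cycleFactor A σ)).prod * cycleFactor A σ j)

end Cdet

/-- The principal submatrix `M_β^β`. -/
def principal {n : ℕ} (M : Matrix (Fin n) (Fin n) ℍ[ℝ]) (β : Finset (Fin n)) :
    Matrix β β ℍ[ℝ] :=
  M.submatrix (fun x => (x : Fin n)) (fun x => (x : Fin n))

/-- The principal minor `|M|_β^β` of a Hermitian matrix `M`. All column determinants of a Hermitian
matrix coincide, and this common value is its determinant; we take the column determinant along
the first column. The empty minor is `1`. -/
noncomputable def principalMinor {n : ℕ} (M : Matrix (Fin n) (Fin n) ℍ[ℝ])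
    (β : Finset (Fin n)) : ℍ[ℝ] :=
  if h : β.Nonempty then cdet (principal M β) ⟨β.min' h, β.min'_mem h⟩ else 1

/-- The sum `∑_{β ∈ J_{r,n}} |M|_β^β` of the principal minors of order `r` of a Hermitian
matrix. -/
noncomputable def minorSum {n : ℕ} (r : ℕ) (M : Matrix (Fin n) (Fin n) ℍ[ℝ]) : ℍ[ℝ] :=
  ∑ β : {β : Finset (Fin n) // β.card = r}, principalMinor M β.1

/-- The matrix whose `(i, j)` entry is `∑_{β ∈ J_{r,n}{i}} cdet_i ((M_{.i}(b_{.j}))_β^β)`, where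
`M_{.i}(b_{.j})` is `M` with its `i`-th column replaced by the `j`-th column of `B`, and
`J_{r,n}{i}` is the set of the `r`-element sets of indices that contain `i`. -/
noncomputable def cdetSum {n p : ℕ} (r : ℕ) (M : Matrix (Fin n) (Fin n) ℍ[ℝ])
    (B : Matrix (Fin n) (Fin p) ℍ[ℝ]) : Matrix (Fin n) (Fin p) ℍ[ℝ] :=
  Matrix.of fun i j => ∑ β : {β : Finset (Fin n) // β.card = r ∧ i ∈ β},
    cdet (principal (M.updateCol i fun l => B l j) β.1) ⟨i, β.2.2⟩

end QMat

/-! With `V = A * W`, the matrix `D = A^{d,W} W` is the Drazin inverse of `V`, so `A^{†,d,W} = A† V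
D`. Both formulas come from applying a Cramer rule several times, each application multiplying the
result by a real nonzero sum of principal minors. The final division removes these scalars.

The Cramer rule rests on cofactors. Expanding `cdet_p` along a replaced column gives coefficients
`cofactor M β p q`, and `cofactor_of_ne` computes them recursively by deleting an index from a
cycle. For Hermitian `M`, strong induction on `β` (`cofactorSpec`) shows that principal minors are
real, that `star` transposes the cofactors, and that the cofactor matrix on `β` times the principal
submatrix is the minor times the identity.

Summing over all `β` with `k` elements gives matrices `adjSum k M` with `adjSum k M * M + adjSum (k
+ 1) M = d_k • 1`, where `d_k = minorSum k M`: the Faddeev-LeVerrier recursion. Let `a` be the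
largest order with `d_a ≠ 0`. Running the recursion beyond order `n` yields `adjSum (a + 1) M * M =
0`, hence `adjSum a M * (M * M) = d_a • M`, and comparing traces gives `a = rank M`
(`minorSum_rank`). So `cdetSum` turns `M * (M * Y)` into `d_a • (M * Y)`, and for `M = Bᴴ * B` it
turns `Bᴴ * C` into a multiple of `B† C`.

In (i), `D = V ^ k * X * V ^ k` with `X` the Moore-Penrose inverse of `V ^ (2 * k + 1)`. The
matrices `Ψ` and `Υ` each apply the rule once, so that `V ^ (k + 1) * Υ` is a multiple of `V * D * D
* V = V * D`. In (ii) the rule for the Hermitian matrix `V ^ (k + 2)` gives a multiple of `D`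
directly. The rule for `A` then supplies `A†`. -/

namespace QMat

/-! ### Column determinants of principal submatrices through permutations of the index set -/

section Cofactor

variable {n : ℕ}

/-- The permutations that fix every index outside `β`. -/
def permsOn (β : Finset (Fin n)) : Finset (Equiv.Perm (Fin n)) :=
  Finset.univ.filter fun σ => ∀ x, x ∉ β → σ x = x

theorem mem_permsOn {β : Finset (Fin n)} {σ : Equiv.Perm (Fin n)} :
    σ ∈ permsOn β ↔ ∀ x, x ∉ β → σ x = x := by
  simp [permsOn]

open Classical in
/-- The least elements of the cycles of `σ` in `β`. -/
noncomputable def cycleMins (β : Finset (Fin n)) (σ : Equiv.Perm (Fin n)) : Finset (Fin n) :=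
  β.filter fun c => ∀ d, σ.SameCycle c d → c ≤ d

open Classical in
/-- The least elements of the cycles of `σ` in `β` which do not pass through `p`. -/
noncomputable def cycleMinsOff (β : Finset (Fin n)) (σ : Equiv.Perm (Fin n)) (p : Fin n) :
    Finset (Fin n) :=
  β.filter fun c => ¬ σ.SameCycle p c ∧ ∀ d, σ.SameCycle c d → c ≤ d

/-- The product of the cycle factors with starting points in `s`, which increase from right to
left. -/
noncomputable def headsProd (M : Matrix (Fin n) (Fin n) ℍ[ℝ]) (σ : Equiv.Perm (Fin n))
    (s : Finset (Fin n)) : ℍ[ℝ] :=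
  ((s.sort (· ≥ ·)).map (cycleFactor M σ)).prod

/-- The cycle factor of `c` without its rightmost entry. -/
noncomputable def cycleTail (M : Matrix (Fin n) (Fin n) ℍ[ℝ]) (σ : Equiv.Perm (Fin n))
    (c : Fin n) : ℍ[ℝ] :=
  ((List.range (Function.minimalPeriod σ c - 1)).map
    fun t => M ((σ ^ (t + 2)) c) ((σ ^ (t + 1)) c)).reverse.prod

/-- The determinant of the principal submatrix on `β`, as a sum over permutations. -/
noncomputable def minorOn (M : Matrix (Fin n) (Fin n) ℍ[ℝ]) (β : Finset (Fin n)) : ℍ[ℝ] :=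
  ∑ σ ∈ permsOn β, Equiv.Perm.sign σ • headsProd M σ (cycleMins β σ)

/-- The coefficient of `b q` in the `p`-th column determinant of the principal submatrix on `β` of
`M` with its `p`-th column replaced by `b`. -/
noncomputable def cofactor (M : Matrix (Fin n) (Fin n) ℍ[ℝ]) (β : Finset (Fin n))
    (p q : Fin n) : ℍ[ℝ] :=
  ∑ σ ∈ (permsOn β).filter (fun σ => σ p = q),
    Equiv.Perm.sign σ • (headsProd M σ (cycleMinsOff β σ p) * cycleTail M σ p)

/-! ### Cycle factors and replaced columns. -/

theorem minimalPeriod_perm_pos (σ : Equiv.Perm (Fin n)) (c : Fin n) :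
    0 < Function.minimalPeriod σ c :=
  Function.minimalPeriod_pos_of_mem_periodicPts
    (Function.Injective.mem_periodicPts σ.injective c)

theorem iterate_perm (σ : Equiv.Perm (Fin n)) (t : ℕ) (c : Fin n) :
    σ^[t] c = (σ ^ t) c := by
  rw [Equiv.Perm.iterate_eq_pow]

theorem cycleFactor_eq_cycleTail_mul (M : Matrix (Fin n) (Fin n) ℍ[ℝ]) (σ : Equiv.Perm (Fin n))
    (c : Fin n) : cycleFactor M σ c = cycleTail M σ c * M (σ c) c := by
  obtain ⟨l, hl⟩ := Nat.exists_eq_succ_of_ne_zero (minimalPeriod_perm_pos σ c).ne'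
  rw [cycleFactor, cycleTail, hl, List.range_succ_eq_map, List.map_cons, List.reverse_cons,
    List.prod_append, List.map_map]
  simp [Function.comp_def]

theorem pow_apply_ne_of_lt {σ : Equiv.Perm (Fin n)} {c : Fin n} {s t : ℕ} (hst : s < t)
    (ht : t < Function.minimalPeriod σ c) : (σ ^ s) c ≠ (σ ^ t) c := by
  intro h
  rw [← iterate_perm, ← iterate_perm] at h
  exact hst.ne (Function.iterate_injOn_Iio_minimalPeriod (hst.trans ht) ht h)

theorem cycleFactor_updateCol_of_not_sameCycle (M : Matrix (Fin n) (Fin n) ℍ[ℝ])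
    (σ : Equiv.Perm (Fin n)) {p c : Fin n} (b : Fin n → ℍ[ℝ]) (h : ¬ σ.SameCycle p c) :
    cycleFactor (M.updateCol p b) σ c = cycleFactor M σ c := by
  rw [cycleFactor, cycleFactor]
  congr 2
  refine List.map_congr_left fun t _ => ?_
  rw [Matrix.updateCol_ne]
  intro h'
  apply h
  rw [← h']
  exact (Equiv.Perm.sameCycle_pow_left).2 (Equiv.Perm.SameCycle.refl _ _)

/-- Within one period the orbit meets `p` only at its start, so the tail reads no entry of column
`p`. -/
theorem cycleTail_updateCol (M : Matrix (Fin n) (Fin n) ℍ[ℝ])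
    (σ : Equiv.Perm (Fin n)) (p : Fin n) (b : Fin n → ℍ[ℝ]) :
    cycleTail (M.updateCol p b) σ p = cycleTail M σ p := by
  rw [cycleTail, cycleTail]
  congr 2
  refine List.map_congr_left fun t ht => ?_
  rw [List.mem_range] at ht
  rw [Matrix.updateCol_ne]
  exact (pow_apply_ne_of_lt (s := 0) (Nat.succ_pos t) (by omega)).symm

theorem headsProd_updateCol (M : Matrix (Fin n) (Fin n) ℍ[ℝ]) (β : Finset (Fin n))
    (σ : Equiv.Perm (Fin n)) (p : Fin n) (b : Fin n → ℍ[ℝ]) :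
    headsProd (M.updateCol p b) σ (cycleMinsOff β σ p) = headsProd M σ (cycleMinsOff β σ p) := by
  rw [headsProd, headsProd]
  congr 1
  refine List.map_congr_left fun c hc => ?_
  rw [Finset.mem_sort, cycleMinsOff, Finset.mem_filter] at hc
  exact cycleFactor_updateCol_of_not_sameCycle M σ b hc.2.1

/-! ### From permutations of `β` to permutations fixing its complement. -/

theorem coe_pow_ofSubtype {β : Finset (Fin n)} (σ : Equiv.Perm β) (t : ℕ) (c : β) :
    ((Equiv.Perm.ofSubtype σ) ^ t) (c : Fin n) = ((σ ^ t) c : β) := by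
  rw [← map_pow, Equiv.Perm.ofSubtype_apply_coe]

theorem sameCycle_ofSubtype {β : Finset (Fin n)} (σ : Equiv.Perm β) (c d : β) :
    (Equiv.Perm.ofSubtype σ).SameCycle (c : Fin n) d ↔ σ.SameCycle c d := by
  simp only [Equiv.Perm.SameCycle, ← map_zpow, Equiv.Perm.ofSubtype_apply_coe, Subtype.ext_iff]

theorem mem_of_sameCycle {β : Finset (Fin n)} {σ : Equiv.Perm (Fin n)} (hσ : σ ∈ permsOn β)
    {c d : Fin n} (hc : c ∈ β) (h : σ.SameCycle c d) : d ∈ β := by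
  by_contra hd
  obtain ⟨t, ht⟩ := h.symm
  rw [mem_permsOn] at hσ
  rw [Equiv.Perm.zpow_apply_eq_self_of_apply_eq_self (hσ d hd)] at ht
  exact hd (ht ▸ hc)

theorem minimalPeriod_ofSubtype {β : Finset (Fin n)} (σ : Equiv.Perm β) (c : β) :
    Function.minimalPeriod (Equiv.Perm.ofSubtype σ) (c : Fin n) = Function.minimalPeriod σ c := by
  rw [Function.minimalPeriod_eq_minimalPeriod_iff]
  intro t
  rw [Function.IsPeriodicPt, Function.IsPeriodicPt, Function.IsFixedPt, Function.IsFixedPt,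
    iterate_perm, coe_pow_ofSubtype, Equiv.Perm.iterate_eq_pow, Subtype.ext_iff]

theorem cycleFactor_principal (M : Matrix (Fin n) (Fin n) ℍ[ℝ]) {β : Finset (Fin n)}
    (σ : Equiv.Perm β) (c : β) :
    cycleFactor (principal M β) σ c = cycleFactor M (Equiv.Perm.ofSubtype σ) c := by
  simp only [cycleFactor, minimalPeriod_ofSubtype, coe_pow_ofSubtype, principal,
    Matrix.submatrix_apply]

theorem ofSubtype_mem_permsOn {β : Finset (Fin n)} (σ : Equiv.Perm β) :
    Equiv.Perm.ofSubtype σ ∈ permsOn β :=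
  mem_permsOn.2 fun _ hx => Equiv.Perm.ofSubtype_apply_of_not_mem σ hx

theorem map_cycleHeads {β : Finset (Fin n)} (σ : Equiv.Perm β) (i : β) :
    (cycleHeads σ i).map (fun x : β => (x : Fin n)) =
      (cycleMinsOff β (Equiv.Perm.ofSubtype σ) i).sort (· ≥ ·) := by
  have h := Finset.map_sort (Function.Embedding.subtype fun x => x ∈ β)
    (Finset.univ.filter fun c => ¬ σ.SameCycle i c ∧ ∀ d, σ.SameCycle c d → c ≤ d)
    (· ≥ ·) (· ≥ ·) (fun a _ b _ => by simp)
  rw [cycleHeads]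
  refine Eq.trans ?_ (h.trans ?_)
  · rfl
  · congr 1
    ext c
    simp only [Finset.mem_map, Finset.mem_filter, Finset.mem_univ, true_and, cycleMinsOff,
      Function.Embedding.subtype_apply]
    constructor
    · rintro ⟨c, ⟨h1, h2⟩, rfl⟩
      refine ⟨c.2, by rwa [sameCycle_ofSubtype], fun d hd => ?_⟩
      have hdβ := mem_of_sameCycle (ofSubtype_mem_permsOn σ) c.2 hd
      exact h2 ⟨d, hdβ⟩ ((sameCycle_ofSubtype σ c ⟨d, hdβ⟩).1 hd)
    · rintro ⟨hc, h1, h2⟩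
      refine ⟨⟨c, hc⟩, ⟨?_, fun d hd => ?_⟩, rfl⟩
      · rwa [← sameCycle_ofSubtype]
      · exact h2 d ((sameCycle_ofSubtype σ ⟨c, hc⟩ d).2 hd)

theorem sum_perm_subtype {β : Finset (Fin n)} (f : Equiv.Perm (Fin n) → ℍ[ℝ]) :
    ∑ σ : Equiv.Perm β, f (Equiv.Perm.ofSubtype σ) = ∑ σ ∈ permsOn β, f σ := by
  refine Finset.sum_bij (fun σ _ => Equiv.Perm.ofSubtype σ)
    (fun σ _ => ofSubtype_mem_permsOn σ)
    (fun σ _ τ _ h => Equiv.Perm.ofSubtype_injective h) ?_ (fun _ _ => rfl)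
  intro τ hτ
  have hτ' : ∀ x, τ x ≠ x → x ∈ β := fun x hx => by
    by_contra h
    exact hx (mem_permsOn.1 hτ x h)
  have hm : ∀ x, x ∈ β ↔ τ x ∈ β := fun x =>
    ⟨fun h => mem_of_sameCycle hτ h ⟨1, rfl⟩, fun h => mem_of_sameCycle hτ h ⟨-1, by simp⟩⟩
  exact ⟨τ.subtypePerm fun x => (hm x).symm, Finset.mem_univ _,
    Equiv.Perm.ofSubtype_subtypePerm _ hτ'⟩

theorem cdet_principal (M : Matrix (Fin n) (Fin n) ℍ[ℝ]) (β : Finset (Fin n)) (i : β) :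
    cdet (principal M β) i = ∑ σ ∈ permsOn β, Equiv.Perm.sign σ •
      (headsProd M σ (cycleMinsOff β σ i) * cycleFactor M σ i) := by
  rw [cdet, ← sum_perm_subtype fun σ => Equiv.Perm.sign σ •
      (headsProd M σ (cycleMinsOff β σ i) * cycleFactor M σ i)]
  refine Finset.sum_congr rfl fun σ _ => ?_
  rw [Equiv.Perm.sign_ofSubtype, cycleFactor_principal, headsProd, ← map_cycleHeads, List.map_map]
  congr 4
  ext1 c
  exact cycleFactor_principal M σ c

theorem apply_mem_of_mem {β : Finset (Fin n)} {σ : Equiv.Perm (Fin n)} (hσ : σ ∈ permsOn β)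
    {c : Fin n} (hc : c ∈ β) : σ c ∈ β :=
  mem_of_sameCycle hσ hc ⟨1, rfl⟩

theorem sum_cycleTail_mul (M : Matrix (Fin n) (Fin n) ℍ[ℝ]) (β : Finset (Fin n)) {i : Fin n}
    (hi : i ∈ β) (b : Fin n → ℍ[ℝ]) :
    ∑ σ ∈ permsOn β, Equiv.Perm.sign σ •
      (headsProd M σ (cycleMinsOff β σ i) * (cycleTail M σ i * b (σ i))) =
      ∑ q ∈ β, cofactor M β i q * b q := by
  rw [← Finset.sum_fiberwise_of_maps_to (g := fun σ : Equiv.Perm (Fin n) => σ i) (t := β)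
    (fun σ hσ => apply_mem_of_mem hσ hi)]
  refine Finset.sum_congr rfl fun q _ => ?_
  rw [cofactor, Finset.sum_mul]
  refine Finset.sum_congr rfl fun σ hσ => ?_
  rw [(Finset.mem_filter.1 hσ).2, smul_mul_assoc, mul_assoc]

/-- Expansion of a column determinant along the replaced column. -/
theorem cdet_principal_updateCol (M : Matrix (Fin n) (Fin n) ℍ[ℝ]) (β : Finset (Fin n)) (i : β)
    (b : Fin n → ℍ[ℝ]) :
    cdet (principal (M.updateCol i b) β) i = ∑ q ∈ β, cofactor M β i q * b q := by
  rw [cdet_principal, ← sum_cycleTail_mul M β i.2]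
  refine Finset.sum_congr rfl fun σ _ => ?_
  rw [headsProd_updateCol, cycleFactor_eq_cycleTail_mul, cycleTail_updateCol,
    Matrix.updateCol_self]

theorem sort_ge_insert {s : Finset (Fin n)} {a : Fin n} (h : ∀ b ∈ s, a < b) :
    (insert a s).sort (· ≥ ·) = s.sort (· ≥ ·) ++ [a] := by
  have ha : a ∉ s := fun h' => (h a h').false
  refine List.Perm.eq_of_pairwise' (Finset.pairwise_sort _ _) ?_ ?_ (r := (· ≥ ·))
  · rw [List.pairwise_append]
    refine ⟨Finset.pairwise_sort _ _, List.pairwise_singleton _ _, fun b hb c hc => ?_⟩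
    rw [List.mem_singleton] at hc
    rw [hc]
    exact (h b ((Finset.mem_sort _).1 hb)).le
  · rw [← Multiset.coe_eq_coe, Finset.sort_eq, Finset.insert_val_of_notMem ha,
      ← Multiset.coe_add, Finset.sort_eq, Multiset.coe_singleton, add_comm,
      Multiset.singleton_add]

/-- The least index of `β` heads its own cycle and lies below every other head, so its factor stands
rightmost. Hence `minorOn` is the column determinant along the least index. -/
theorem headsProd_cycleMins (M : Matrix (Fin n) (Fin n) ℍ[ℝ]) {β : Finset (Fin n)} {p : Fin n}
    (hp : p ∈ β) (hmin : ∀ x ∈ β, p ≤ x) {σ : Equiv.Perm (Fin n)} (hσ : σ ∈ permsOn β) :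
    headsProd M σ (cycleMins β σ) =
      headsProd M σ (cycleMinsOff β σ p) * cycleFactor M σ p := by
  have h : cycleMins β σ = insert p (cycleMinsOff β σ p) := by
    ext c
    simp only [cycleMins, cycleMinsOff, Finset.mem_filter, Finset.mem_insert]
    constructor
    · rintro ⟨hc, h⟩
      by_cases hpc : σ.SameCycle p c
      · exact Or.inl (le_antisymm (h p hpc.symm) (hmin c hc))
      · exact Or.inr ⟨hc, hpc, h⟩
    · rintro (rfl | ⟨hc, -, h⟩)
      · exact ⟨hp, fun d hd => hmin d (mem_of_sameCycle hσ hp hd)⟩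
      · exact ⟨hc, h⟩
  rw [headsProd, h, sort_ge_insert]
  · simp [headsProd]
  · intro b hb
    simp only [cycleMinsOff, Finset.mem_filter] at hb
    refine lt_of_le_of_ne (hmin b hb.1) ?_
    rintro rfl
    exact hb.2.1 (Equiv.Perm.SameCycle.refl _ _)

theorem minorOn_eq_sum_cofactor (M : Matrix (Fin n) (Fin n) ℍ[ℝ]) {β : Finset (Fin n)} {p : Fin n}
    (hp : p ∈ β) (hmin : ∀ x ∈ β, p ≤ x) :
    minorOn M β = ∑ q ∈ β, cofactor M β p q * M q p := by
  rw [← sum_cycleTail_mul M β hp fun q => M q p, minorOn]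
  refine Finset.sum_congr rfl fun σ hσ => ?_
  rw [headsProd_cycleMins M hp hmin hσ, cycleFactor_eq_cycleTail_mul]

theorem principalMinor_eq_minorOn (M : Matrix (Fin n) (Fin n) ℍ[ℝ]) (β : Finset (Fin n)) :
    principalMinor M β = minorOn M β := by
  rw [principalMinor]
  split_ifs with h
  · rw [cdet_principal, minorOn]
    refine Finset.sum_congr rfl fun σ hσ => ?_
    rw [headsProd_cycleMins M (β.min'_mem h) (fun x hx => β.min'_le x hx) hσ]
  · rw [Finset.not_nonempty_iff_eq_empty] at h
    subst h
    have : permsOn (∅ : Finset (Fin n)) = {1} := by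
      ext σ
      simp [mem_permsOn, Equiv.ext_iff]
    simp [minorOn, this, cycleMins, headsProd]

/-- Deleting the row and the column of a diagonal cofactor. -/
theorem cofactor_self (M : Matrix (Fin n) (Fin n) ℍ[ℝ]) {β : Finset (Fin n)} {p : Fin n} :
    cofactor M β p p = minorOn M (β.erase p) := by
  rw [cofactor, minorOn]
  refine Finset.sum_congr ?_ fun σ hσ => ?_
  · ext σ
    simp only [Finset.mem_filter, mem_permsOn, Finset.mem_erase, not_and_or, not_not]
    exact ⟨fun h x hx => hx.elim (fun e => e ▸ h.2) (h.1 x),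
      fun h => ⟨fun x hx => h x (Or.inr hx), h p (Or.inl rfl)⟩⟩
  · have hp : σ p = p := mem_permsOn.1 hσ p (by simp)
    have hsc : ∀ c, σ.SameCycle p c ↔ c = p := fun c =>
      ⟨fun ⟨t, ht⟩ => by
        rw [Equiv.Perm.zpow_apply_eq_self_of_apply_eq_self hp] at ht
        exact ht.symm, fun h => h ▸ Equiv.Perm.SameCycle.refl _ _⟩
    have h1 : cycleMinsOff β σ p = cycleMins (β.erase p) σ := by
      ext c
      simp only [cycleMins, cycleMinsOff, Finset.mem_filter, Finset.mem_erase, hsc]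
      tauto
    have h2 : Function.minimalPeriod σ p = 1 :=
      Function.minimalPeriod_eq_one_iff_isFixedPt.2 hp
    rw [h1, cycleTail, h2]
    simp

/-! ### Removing one index from a cycle. -/

section Swap

variable {σ : Equiv.Perm (Fin n)} {p q : Fin n}

theorem mul_swap_apply_self (hq : σ p = q) : (σ * Equiv.swap p q) q = q := by
  simp [hq]

theorem pow_mul_swap_apply_of_not_sameCycle (hq : σ p = q) {c : Fin n}
    (hc : ¬ σ.SameCycle p c) (t : ℕ) : ((σ * Equiv.swap p q) ^ t) c = (σ ^ t) c := by
  induction t with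
  | zero => rfl
  | succ t ih =>
    have hsc : σ.SameCycle c ((σ ^ t) c) := ⟨t, by simp⟩
    have h1 : (σ ^ t) c ≠ p := fun h => hc (h ▸ hsc).symm
    have h2 : (σ ^ t) c ≠ q := fun h => by
      rw [h, ← hq] at hsc
      exact hc (Equiv.Perm.sameCycle_apply_right.1 hsc).symm
    rw [pow_succ', Equiv.Perm.mul_apply, ih, Equiv.Perm.mul_apply,
      Equiv.swap_apply_of_ne_of_ne h1 h2, pow_succ', Equiv.Perm.mul_apply]

theorem sameCycle_iff_exists_nat_pow {τ : Equiv.Perm (Fin n)} {c d : Fin n} :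
    τ.SameCycle c d ↔ ∃ t : ℕ, (τ ^ t) c = d :=
  ⟨fun h => h.exists_nat_pow_eq, fun ⟨t, ht⟩ => ⟨t, by simpa using ht⟩⟩

theorem sameCycle_mul_swap_of_not_sameCycle (hq : σ p = q) {c : Fin n}
    (hc : ¬ σ.SameCycle p c) (d : Fin n) :
    (σ * Equiv.swap p q).SameCycle c d ↔ σ.SameCycle c d := by
  simp only [sameCycle_iff_exists_nat_pow, pow_mul_swap_apply_of_not_sameCycle hq hc]

theorem cycleFactor_mul_swap_of_not_sameCycle (M : Matrix (Fin n) (Fin n) ℍ[ℝ]) (hq : σ p = q)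
    {c : Fin n} (hc : ¬ σ.SameCycle p c) :
    cycleFactor M (σ * Equiv.swap p q) c = cycleFactor M σ c := by
  have h : Function.minimalPeriod (σ * Equiv.swap p q) c = Function.minimalPeriod σ c := by
    rw [Function.minimalPeriod_eq_minimalPeriod_iff]
    intro t
    rw [Function.IsPeriodicPt, Function.IsPeriodicPt, Function.IsFixedPt, Function.IsFixedPt,
      iterate_perm, iterate_perm, pow_mul_swap_apply_of_not_sameCycle hq hc]
  simp only [cycleFactor, h, pow_mul_swap_apply_of_not_sameCycle hq hc]

theorem one_lt_minimalPeriod (hq : σ p = q) (hpq : p ≠ q) : 1 < Function.minimalPeriod σ p := by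
  have h0 := minimalPeriod_perm_pos σ p
  have h1 : Function.minimalPeriod σ p ≠ 1 := fun h =>
    hpq ((Function.minimalPeriod_eq_one_iff_isFixedPt.1 h).symm.trans hq)
  omega

/-- The new permutation sends `p` straight to `σ q` and then follows `σ`, so it runs one step ahead
until the cycle closes. -/
theorem pow_mul_swap_apply (hq : σ p = q) {t : ℕ}
    (ht : t + 1 < Function.minimalPeriod σ p) :
    ((σ * Equiv.swap p q) ^ (t + 1)) p = (σ ^ (t + 2)) p := by
  induction t with
  | zero => simp [pow_two, hq]
  | succ t ih =>
    have h1 : (σ ^ (t + 2)) p ≠ p := (pow_apply_ne_of_lt (s := 0) (by omega) ht).symm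
    have h2 : (σ ^ (t + 2)) p ≠ q := by
      have := (pow_apply_ne_of_lt (s := 1) (by omega) ht).symm
      rwa [pow_one, hq] at this
    rw [pow_succ', Equiv.Perm.mul_apply, ih (by omega), Equiv.Perm.mul_apply,
      Equiv.swap_apply_of_ne_of_ne h1 h2, ← Equiv.Perm.mul_apply, ← pow_succ']

theorem pow_minimalPeriod_apply (σ : Equiv.Perm (Fin n)) (p : Fin n) :
    (σ ^ Function.minimalPeriod σ p) p = p := by
  rw [← iterate_perm]
  exact Function.iterate_minimalPeriod

theorem minimalPeriod_mul_swap (hq : σ p = q) (hpq : p ≠ q) :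
    Function.minimalPeriod (σ * Equiv.swap p q) p + 1 = Function.minimalPeriod σ p := by
  obtain ⟨l, hl⟩ : ∃ l, Function.minimalPeriod σ p = l + 2 :=
    ⟨_, (Nat.sub_add_cancel (one_lt_minimalPeriod hq hpq)).symm⟩
  have h1 : ((σ * Equiv.swap p q) ^ (l + 1)) p = p := by
    rw [pow_mul_swap_apply hq (by omega), ← hl, pow_minimalPeriod_apply]
  have h2 : Function.minimalPeriod (σ * Equiv.swap p q) p ≤ l + 1 :=
    Function.IsPeriodicPt.minimalPeriod_le (Nat.succ_pos l) (by
      rw [Function.IsPeriodicPt, Function.IsFixedPt, iterate_perm, h1])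
  have h3 := minimalPeriod_perm_pos (σ * Equiv.swap p q) p
  obtain ⟨s, hs⟩ := Nat.exists_eq_succ_of_ne_zero h3.ne'
  have h4 := pow_minimalPeriod_apply (σ * Equiv.swap p q) p
  rw [hs, pow_mul_swap_apply hq (by omega)] at h4
  -- A still shorter period would bring the orbit of `p` under `σ` back too early.
  rcases lt_or_ge s l with h | h
  · exact absurd h4 (pow_apply_ne_of_lt (s := 0) (by omega) (by omega)).symm
  · omega

/-- The tail for `σ` omits the step `p → q`, so its rightmost entry is the one leaving `q`, whose
target `σ q` is the first point after `p` in the shortened cycle. -/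
theorem cycleTail_mul_swap (M : Matrix (Fin n) (Fin n) ℍ[ℝ]) (hq : σ p = q) (hpq : p ≠ q) :
    cycleTail M σ p =
      cycleTail M (σ * Equiv.swap p q) p * M ((σ * Equiv.swap p q) p) q := by
  have h := minimalPeriod_mul_swap hq hpq
  obtain ⟨l, hl⟩ : ∃ l, Function.minimalPeriod σ p = l + 2 :=
    ⟨_, (Nat.sub_add_cancel (one_lt_minimalPeriod hq hpq)).symm⟩
  rw [cycleTail, cycleTail, show Function.minimalPeriod (σ * Equiv.swap p q) p - 1 = l by omega,
    show Function.minimalPeriod σ p - 1 = l + 1 by omega, List.range_succ_eq_map, List.map_cons,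
    List.reverse_cons, List.prod_append, List.map_map]
  congr 1
  · congr 2
    refine List.map_congr_left fun t ht => ?_
    rw [List.mem_range] at ht
    rw [pow_mul_swap_apply hq (by omega), pow_mul_swap_apply hq (by omega)]
    rfl
  · simp [pow_two, hq]

theorem sameCycle_iff_mul_swap (hq : σ p = q) (hpq : p ≠ q) (c : Fin n) :
    σ.SameCycle p c ↔ c = q ∨ (σ * Equiv.swap p q).SameCycle p c := by
  constructor
  · intro h
    obtain ⟨t, ht⟩ := sameCycle_iff_exists_nat_pow.1 h
    rw [← iterate_perm, ← Function.iterate_mod_minimalPeriod_eq, iterate_perm] at ht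
    have hlt := Nat.mod_lt t (minimalPeriod_perm_pos σ p)
    generalize t % Function.minimalPeriod σ p = s at ht hlt
    match s, ht, hlt with
    | 0, ht, _ => exact Or.inr (ht ▸ Equiv.Perm.SameCycle.refl _ _)
    | 1, ht, _ => exact Or.inl (by rw [← ht, pow_one, hq])
    | s + 2, ht, hlt =>
      refine Or.inr (sameCycle_iff_exists_nat_pow.2 ⟨s + 1, ?_⟩)
      rw [pow_mul_swap_apply hq (by omega), ht]
  · rintro (rfl | h)
    · exact ⟨1, by simpa using hq⟩
    · by_contra hc
      exact hc ((sameCycle_mul_swap_of_not_sameCycle hq hc p).1 h.symm).symm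

/-- Erasing `q` from `β` keeps the new fixed point `q` from counting as a head. -/
theorem cycleMinsOff_mul_swap (β : Finset (Fin n)) (hq : σ p = q) (hpq : p ≠ q) :
    cycleMinsOff β σ p = cycleMinsOff (β.erase q) (σ * Equiv.swap p q) p := by
  ext c
  simp only [cycleMinsOff, Finset.mem_filter, Finset.mem_erase]
  by_cases hc : σ.SameCycle p c
  · have := (sameCycle_iff_mul_swap hq hpq c).1 hc
    tauto
  · have := (sameCycle_iff_mul_swap hq hpq c).not.1 hc
    simp only [sameCycle_mul_swap_of_not_sameCycle hq hc]
    tauto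

theorem headsProd_mul_swap (M : Matrix (Fin n) (Fin n) ℍ[ℝ]) (β : Finset (Fin n)) (hq : σ p = q)
    (hpq : p ≠ q) : headsProd M σ (cycleMinsOff β σ p) =
      headsProd M (σ * Equiv.swap p q) (cycleMinsOff (β.erase q) (σ * Equiv.swap p q) p) := by
  rw [← cycleMinsOff_mul_swap β hq hpq, headsProd, headsProd]
  congr 1
  refine List.map_congr_left fun c hc => ?_
  rw [Finset.mem_sort, cycleMinsOff, Finset.mem_filter] at hc
  rw [cycleFactor_mul_swap_of_not_sameCycle M hq hc.2.1]

end Swap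

/-- Deleting the first step of the cycle through `p` in an off-diagonal cofactor. -/
theorem cofactor_of_ne (M : Matrix (Fin n) (Fin n) ℍ[ℝ]) {β : Finset (Fin n)} {p q : Fin n}
    (hp : p ∈ β) (hq : q ∈ β) (hpq : p ≠ q) :
    cofactor M β p q = -∑ x ∈ β.erase q, cofactor M (β.erase q) p x * M x q := by
  rw [← sum_cycleTail_mul M (β.erase q) (Finset.mem_erase.2 ⟨hpq, hp⟩) fun x => M x q, cofactor,
    ← Finset.sum_neg_distrib]
  -- Right multiplication by the transposition is its own inverse. It replaces `p → q → x` by `p →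
  -- x`, makes `q` a fixed point, leaves the other cycles alone and flips the sign.
  refine Finset.sum_bij' (fun σ _ => σ * Equiv.swap p q) (fun σ _ => σ * Equiv.swap p q)
    ?_ ?_ ?_ ?_ ?_
  · intro σ hσ
    rw [Finset.mem_filter, mem_permsOn] at hσ
    rw [mem_permsOn]
    intro x hx
    by_cases hxq : x = q
    · rw [hxq, mul_swap_apply_self hσ.2]
    · have hxβ : x ∉ β := fun h => hx (Finset.mem_erase.2 ⟨hxq, h⟩)
      rw [Equiv.Perm.mul_apply, Equiv.swap_apply_of_ne_of_ne (ne_of_mem_of_not_mem hp hxβ |>.symm) hxq,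
        hσ.1 x hxβ]
  · intro σ hσ
    rw [mem_permsOn] at hσ
    rw [Finset.mem_filter, mem_permsOn]
    refine ⟨fun x hx => ?_, ?_⟩
    · rw [Equiv.Perm.mul_apply, Equiv.swap_apply_of_ne_of_ne (ne_of_mem_of_not_mem hp hx).symm
        (ne_of_mem_of_not_mem hq hx).symm, hσ x fun h => hx (Finset.mem_of_mem_erase h)]
    · rw [Equiv.Perm.mul_apply, Equiv.swap_apply_left, hσ q (by simp)]
  · intro σ _
    simp [mul_assoc]
  · intro σ _
    simp [mul_assoc]
  · intro σ hσ
    rw [Finset.mem_filter] at hσ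
    rw [headsProd_mul_swap M β hσ.2 hpq, cycleTail_mul_swap M hσ.2 hpq, Equiv.Perm.sign_mul,
      Equiv.Perm.sign_swap hpq]
    simp [Units.smul_def]

/-! ### Continuity -/

theorem continuous_cycleFactor (σ : Equiv.Perm (Fin n)) (c : Fin n) :
    Continuous fun M : Matrix (Fin n) (Fin n) ℍ[ℝ] => cycleFactor M σ c := by
  simp only [cycleFactor, ← List.map_reverse]
  exact continuous_list_prod _ fun t _ => by fun_prop

theorem continuous_cycleTail (σ : Equiv.Perm (Fin n)) (c : Fin n) :
    Continuous fun M : Matrix (Fin n) (Fin n) ℍ[ℝ] => cycleTail M σ c := by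
  simp only [cycleTail, ← List.map_reverse]
  exact continuous_list_prod _ fun t _ => by fun_prop

theorem continuous_headsProd (σ : Equiv.Perm (Fin n)) (s : Finset (Fin n)) :
    Continuous fun M : Matrix (Fin n) (Fin n) ℍ[ℝ] => headsProd M σ s :=
  continuous_list_prod _ fun c _ => continuous_cycleFactor σ c

theorem continuous_cofactor (β : Finset (Fin n)) (p q : Fin n) :
    Continuous fun M : Matrix (Fin n) (Fin n) ℍ[ℝ] => cofactor M β p q := by
  simp only [cofactor, Units.smul_def]
  refine continuous_finsetSum _ fun σ _ => Continuous.const_smul ?_ _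
  exact (continuous_headsProd σ _).mul (continuous_cycleTail σ p)

end Cofactor

/-! ### Cofactors of Hermitian matrices -/

section Hermitian

variable {n : ℕ}

theorem commute_of_star_eq_self {a : ℍ[ℝ]} (h : star a = a) (b : ℍ[ℝ]) : a * b = b * a := by
  rw [Quaternion.star_eq_self] at h
  rw [h, Quaternion.coe_commutes]

theorem minorOn_empty (M : Matrix (Fin n) (Fin n) ℍ[ℝ]) : minorOn M ∅ = 1 := by
  rw [← principalMinor_eq_minorOn]
  simp [principalMinor]

/-- The three properties of the cofactors of `M` on `β` that are carried through the induction. -/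
structure CofactorSpec (M : Matrix (Fin n) (Fin n) ℍ[ℝ]) (β : Finset (Fin n)) : Prop where
  star_minorOn : star (minorOn M β) = minorOn M β
  star_cofactor : ∀ p ∈ β, ∀ q ∈ β, star (cofactor M β p q) = cofactor M β q p
  sum_mul : ∀ p ∈ β, ∀ s ∈ β, ∑ q ∈ β, cofactor M β p q * M q s = if p = s then minorOn M β else 0

variable {M : Matrix (Fin n) (Fin n) ℍ[ℝ]} {β : Finset (Fin n)}

/-- The involution reverses products, so deletion along a column becomes deletion along a row. -/
theorem star_cofactor_of_ne (hM : M.IsHermitian) {p q : Fin n} (hp : p ∈ β) (hq : q ∈ β)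
    (hpq : p ≠ q) (h : ∀ x ∈ β.erase p, ∀ y ∈ β.erase p,
      star (cofactor M (β.erase p) x y) = cofactor M (β.erase p) y x) :
    star (cofactor M β q p) = -∑ x ∈ β.erase p, M p x * cofactor M (β.erase p) x q := by
  rw [cofactor_of_ne M hq hp hpq.symm, star_neg, star_sum]
  congr 1
  refine Finset.sum_congr rfl fun x hx => ?_
  rw [star_mul, hM.apply, h q (Finset.mem_erase.2 ⟨hpq.symm, hq⟩) x hx]

/-- Deleting first along column `q` and then along row `p` leaves cofactors on `β` without both
indices, an expression that `star` turns into the one with `p` and `q` exchanged. -/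
theorem cofactor_eq_double_sum (hM : M.IsHermitian) {p q : Fin n} (hp : p ∈ β) (hq : q ∈ β)
    (hpq : p ≠ q) (h : ∀ γ ⊂ β, CofactorSpec M γ) :
    cofactor M β p q = -(minorOn M ((β.erase q).erase p) * M p q) +
      ∑ x ∈ (β.erase q).erase p, ∑ y ∈ (β.erase q).erase p,
        M p y * cofactor M ((β.erase q).erase p) y x * M x q := by
  have hpe : p ∈ β.erase q := Finset.mem_erase.2 ⟨hpq, hp⟩
  have hs1 : β.erase q ⊂ β := Finset.erase_ssubset hq
  have hs2 : (β.erase q).erase p ⊂ β := (Finset.erase_ssubset hpe).trans hs1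
  rw [cofactor_of_ne M hp hq hpq, ← Finset.add_sum_erase _ _ hpe, cofactor_self, neg_add,
    ← Finset.sum_neg_distrib]
  congr 1
  refine Finset.sum_congr rfl fun x hx => ?_
  have hxq := Finset.mem_of_mem_erase hx
  rw [← (h _ hs1).star_cofactor x hxq p hpe,
    star_cofactor_of_ne hM hpe hxq (Finset.ne_of_mem_erase hx).symm (h _ hs2).star_cofactor,
    neg_mul, neg_neg, Finset.sum_mul]

theorem star_cofactor_of_ssubset (hM : M.IsHermitian) (h : ∀ γ ⊂ β, CofactorSpec M γ) :
    ∀ p ∈ β, ∀ q ∈ β, star (cofactor M β p q) = cofactor M β q p := by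
  intro p hp q hq
  by_cases hpq : p = q
  · subst hpq
    rw [cofactor_self, (h _ (Finset.erase_ssubset hp)).star_minorOn]
  · have hs : (β.erase q).erase p ⊂ β :=
      (Finset.erase_ssubset (Finset.mem_erase.2 ⟨hpq, hp⟩)).trans (Finset.erase_ssubset hq)
    rw [cofactor_eq_double_sum hM hp hq hpq h, cofactor_eq_double_sum hM hq hp (Ne.symm hpq) h,
      Finset.erase_right_comm (a := p) (b := q), star_add, star_neg, star_mul,
      (h _ hs).star_minorOn, hM.apply, commute_of_star_eq_self (h _ hs).star_minorOn, star_sum,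
      Finset.sum_comm]
    congr 1
    refine Finset.sum_congr rfl fun x hx => ?_
    rw [star_sum]
    refine Finset.sum_congr rfl fun y hy => ?_
    rw [star_mul, star_mul, (h _ hs).star_cofactor _ hy _ hx, hM.apply, hM.apply, mul_assoc]

theorem sum_cofactor_mul_eq (hM : M.IsHermitian) (h : ∀ γ ⊂ β, CofactorSpec M γ) {p : Fin n}
    (hp : p ∈ β) (s : Fin n) :
    ∑ q ∈ β, cofactor M β p q * M q s = minorOn M (β.erase p) * M p s -
      ∑ q ∈ β.erase p, ∑ x ∈ β.erase p, M p x * cofactor M (β.erase p) x q * M q s := by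
  rw [← Finset.add_sum_erase _ _ hp, cofactor_self, sub_eq_add_neg, ← Finset.sum_neg_distrib]
  congr 1
  refine Finset.sum_congr rfl fun q hq => ?_
  have hqβ := Finset.mem_of_mem_erase hq
  rw [← star_cofactor_of_ssubset hM h q hqβ p hp,
    star_cofactor_of_ne hM hp hqβ (Finset.ne_of_mem_erase hq).symm
      (h _ (Finset.erase_ssubset hp)).star_cofactor, neg_mul, Finset.sum_mul]

/-- Orthogonality on `β.erase p` collapses the double sum to its term `x = s`, which cancels the
leading term because the smaller minor is real and hence central. -/
theorem sum_cofactor_mul_of_ne (hM : M.IsHermitian) (h : ∀ γ ⊂ β, CofactorSpec M γ) {p s : Fin n}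
    (hp : p ∈ β) (hs : s ∈ β) (hps : p ≠ s) : ∑ q ∈ β, cofactor M β p q * M q s = 0 := by
  have hγ := h _ (Finset.erase_ssubset hp)
  have hse : s ∈ β.erase p := Finset.mem_erase.2 ⟨hps.symm, hs⟩
  rw [sum_cofactor_mul_eq hM h hp, Finset.sum_comm, sub_eq_zero]
  have h1 : ∀ x ∈ β.erase p, ∑ q ∈ β.erase p, M p x * cofactor M (β.erase p) x q * M q s =
      if x = s then M p x * minorOn M (β.erase p) else 0 := by
    intro x hx
    simp only [mul_assoc]
    rw [← Finset.mul_sum, hγ.sum_mul x hx s hse, mul_ite, mul_zero]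
  rw [Finset.sum_congr rfl h1, Finset.sum_ite_eq' _ _ _, if_pos hse,
    commute_of_star_eq_self hγ.star_minorOn]

theorem star_sum_cofactor_mul (hM : M.IsHermitian) (h : ∀ γ ⊂ β, CofactorSpec M γ) {p : Fin n}
    (hp : p ∈ β) : star (∑ q ∈ β, cofactor M β p q * M q p) = ∑ q ∈ β, cofactor M β p q * M q p := by
  have hγ := h _ (Finset.erase_ssubset hp)
  rw [sum_cofactor_mul_eq hM h hp, star_sub, star_mul, hM.apply, hγ.star_minorOn,
    commute_of_star_eq_self hγ.star_minorOn, star_sum]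
  conv_rhs => rw [Finset.sum_comm]
  congr 1
  refine Finset.sum_congr rfl fun x hx => ?_
  rw [star_sum]
  refine Finset.sum_congr rfl fun y hy => ?_
  rw [star_mul, star_mul, hγ.star_cofactor _ hy _ hx, hM.apply, hM.apply, mul_assoc]

/-- With `C` the cofactor matrix on `β`, the `(p, s)` entry of `M C M` is evaluated by both
associations. Off-diagonal sums vanish, leaving `M p s` times either diagonal sum, and `M p s`
cancels. -/
theorem sum_cofactor_mul_eq_of_apply_ne_zero (hM : M.IsHermitian)
    (h : ∀ γ ⊂ β, CofactorSpec M γ) {p s : Fin n} (hp : p ∈ β) (hs : s ∈ β) (hps : M p s ≠ 0) :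
    ∑ q ∈ β, cofactor M β p q * M q p = ∑ q ∈ β, cofactor M β s q * M q s := by
  have h1 : ∑ q ∈ β, M p q * ∑ t ∈ β, cofactor M β q t * M t s =
      M p s * ∑ t ∈ β, cofactor M β s t * M t s := by
    rw [Finset.sum_eq_single_of_mem s hs]
    intro q hq hqs
    rw [sum_cofactor_mul_of_ne hM h hq hs hqs, mul_zero]
  have h2 : ∀ t ∈ β, ∑ q ∈ β, M p q * cofactor M β q t =
      star (∑ q ∈ β, cofactor M β t q * M q p) := by
    intro t ht
    rw [star_sum]
    refine Finset.sum_congr rfl fun q hq => ?_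
    rw [star_mul, hM.apply, star_cofactor_of_ssubset hM h t ht q hq]
  have h3 : ∑ q ∈ β, M p q * ∑ t ∈ β, cofactor M β q t * M t s =
      M p s * ∑ t ∈ β, cofactor M β p t * M t p := by
    simp only [Finset.mul_sum, ← mul_assoc]
    rw [Finset.sum_comm]
    simp only [← Finset.sum_mul]
    rw [Finset.sum_eq_single_of_mem p hp]
    · rw [h2 p hp, star_sum_cofactor_mul hM h hp,
        commute_of_star_eq_self (star_sum_cofactor_mul hM h hp)]
      simp only [Finset.mul_sum, mul_assoc]
    · intro t ht htp
      rw [h2 t ht, sum_cofactor_mul_of_ne hM h ht hp htp, star_zero, zero_mul]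
  exact mul_left_cancel₀ hps (h3.symm.trans h1)

/-- The Hermitian matrix `M` with the real number `ε` added to its entries `(p, s)` and `(s, p)`. -/
noncomputable def perturb (M : Matrix (Fin n) (Fin n) ℍ[ℝ]) (p s : Fin n) (ε : ℝ) :
    Matrix (Fin n) (Fin n) ℍ[ℝ] :=
  M + ε • (Matrix.single p s 1 + Matrix.single s p 1)

theorem isHermitian_perturb (hM : M.IsHermitian) (p s : Fin n) (ε : ℝ) :
    (perturb M p s ε).IsHermitian := by
  have h : (Matrix.single p s (1 : ℍ[ℝ]) + Matrix.single s p 1)ᴴ =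
      Matrix.single p s 1 + Matrix.single s p 1 := by
    rw [Matrix.conjTranspose_add, Matrix.conjTranspose_single, Matrix.conjTranspose_single,
      star_one, add_comm]
  refine hM.add ?_
  ext1 i j
  rw [Matrix.conjTranspose_apply, Matrix.smul_apply, Matrix.smul_apply, Quaternion.star_smul,
    ← Matrix.conjTranspose_apply, h]

theorem continuous_perturb (M : Matrix (Fin n) (Fin n) ℍ[ℝ]) (p s : Fin n) :
    Continuous (perturb M p s) := by
  unfold perturb
  fun_prop

theorem sum_cofactor_mul_eq_sum (hM : M.IsHermitian)
    (h : ∀ γ ⊂ β, ∀ M : Matrix (Fin n) (Fin n) ℍ[ℝ], M.IsHermitian → CofactorSpec M γ)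
    {p s : Fin n} (hp : p ∈ β) (hs : s ∈ β) :
    ∑ q ∈ β, cofactor M β p q * M q p = ∑ q ∈ β, cofactor M β s q * M q s := by
  by_cases hps : p = s
  · rw [hps]
  by_cases h0 : M p s = 0
  · have hc : ∀ t, Continuous fun ε : ℝ =>
        ∑ q ∈ β, cofactor (perturb M p s ε) β t q * perturb M p s ε q t := by
      intro t
      refine continuous_finsetSum _ fun q _ => ?_
      exact ((continuous_cofactor β t q).comp (continuous_perturb M p s)).mul
        ((continuous_perturb M p s).matrix_elem q t)
    -- For `ε ≠ 0` the perturbed entry is nonzero; both sides are continuous in `ε`, so they also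
    -- agree at `ε = 0`.
    have heq := (hc p).ext_on (dense_compl_singleton (0 : ℝ)) (hc s) fun ε hε => by
      refine sum_cofactor_mul_eq_of_apply_ne_zero (isHermitian_perturb hM p s ε)
        (fun γ hγ => h γ hγ _ (isHermitian_perturb hM p s ε)) hp hs ?_
      have : perturb M p s ε p s = ε • 1 := by
        simp [perturb, h0, Ne.symm hps]
      rw [this]
      exact smul_ne_zero hε one_ne_zero
    have := congrFun heq 0
    simpa [perturb] using this
  · exact sum_cofactor_mul_eq_of_apply_ne_zero hM (fun γ hγ => h γ hγ M hM) hp hs h0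

theorem cofactorSpec (β : Finset (Fin n)) :
    ∀ M : Matrix (Fin n) (Fin n) ℍ[ℝ], M.IsHermitian → CofactorSpec M β := by
  induction β using Finset.strongInduction with
  | H β ih =>
    intro M hM
    have h : ∀ γ ⊂ β, CofactorSpec M γ := fun γ hγ => ih γ hγ M hM
    have hD : ∀ p ∈ β, ∑ q ∈ β, cofactor M β p q * M q p = minorOn M β := by
      intro p hp
      have hne : β.Nonempty := ⟨p, hp⟩
      rw [minorOn_eq_sum_cofactor M (β.min'_mem hne) fun x hx => β.min'_le x hx]
      exact sum_cofactor_mul_eq_sum hM ih hp (β.min'_mem hne)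
    refine ⟨?_, star_cofactor_of_ssubset hM h, fun p hp s hs => ?_⟩
    · rcases β.eq_empty_or_nonempty with rfl | ⟨p, hp⟩
      · rw [minorOn_empty, star_one]
      · rw [← hD p hp, star_sum_cofactor_mul hM h hp]
    · split_ifs with hps
      · rw [← hps, hD p hp]
      · exact sum_cofactor_mul_of_ne hM h hp hs hps

end Hermitian

/-! ### Rank and trace -/

theorem rank_mul_le_right {m n p : ℕ} (B : Matrix (Fin m) (Fin p) ℍ[ℝ])
    (Z : Matrix (Fin p) (Fin n) ℍ[ℝ]) : rank (B * Z) ≤ rank Z := by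
  let f : (Fin p → ℍ[ℝ]) →ₗ[(ℍ[ℝ])ᵐᵒᵖ] (Fin m → ℍ[ℝ]) :=
    { toFun := fun v => B *ᵥ v
      map_add' := fun v w => Matrix.mulVec_add B v w
      map_smul' := fun c v => Matrix.mulVec_smul B c v }
  have h : Set.range (B * Z)ᵀ = f '' Set.range Zᵀ := by
    refine Set.Subset.antisymm ?_ ?_
    · rintro _ ⟨j, rfl⟩
      exact ⟨Zᵀ j, ⟨j, rfl⟩, rfl⟩
    · rintro _ ⟨_, ⟨j, rfl⟩, rfl⟩
      exact ⟨j, rfl⟩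
  rw [rank, rank, h, ← Submodule.map_span]
  exact Submodule.finrank_map_le f _

theorem re_mul_comm (a b : ℍ[ℝ]) : (a * b).re = (b * a).re := by
  simp only [Quaternion.re_mul]
  ring

theorem re_sum {ι : Type*} (s : Finset ι) (f : ι → ℍ[ℝ]) :
    (∑ i ∈ s, f i).re = ∑ i ∈ s, (f i).re :=
  map_sum (⟨⟨fun a : ℍ[ℝ] => a.re, rfl⟩, fun _ _ => rfl⟩ : ℍ[ℝ] →+ ℝ) f s

/-- The quaternion trace is not cyclic, but its real part is, which suffices for counting ranks. -/
theorem re_trace_mul_comm {m n : ℕ} (X : Matrix (Fin m) (Fin n) ℍ[ℝ])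
    (Y : Matrix (Fin n) (Fin m) ℍ[ℝ]) : (X * Y).trace.re = (Y * X).trace.re := by
  simp only [Matrix.trace, Matrix.diag_apply, Matrix.mul_apply, re_sum]
  conv_rhs => rw [Finset.sum_comm]
  exact Finset.sum_congr rfl fun i _ => Finset.sum_congr rfl fun j _ => re_mul_comm _ _

/-- A basis of the column space gives a full-rank factorization `P = X * Y`. Idempotency forces `Y *
X = 1`, whose trace is the rank. -/
theorem re_trace_of_isIdempotentElem {n : ℕ} {P : Matrix (Fin n) (Fin n) ℍ[ℝ]} (hP : P * P = P) :
    P.trace.re = rank P := by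
  obtain ⟨S, hS⟩ : ∃ S, S = Submodule.span (ℍ[ℝ])ᵐᵒᵖ (Set.range Pᵀ) := ⟨_, rfl⟩
  have hr : rank P = Module.finrank (ℍ[ℝ])ᵐᵒᵖ S := by rw [hS, rank]
  let b := Module.finBasis (ℍ[ℝ])ᵐᵒᵖ S
  let X : Matrix (Fin n) (Fin (Module.finrank (ℍ[ℝ])ᵐᵒᵖ S)) ℍ[ℝ] :=
    Matrix.of fun i j => (b j : Fin n → ℍ[ℝ]) i
  have hX : Submodule.span (ℍ[ℝ])ᵐᵒᵖ (Set.range Xᵀ) = S := by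
    have h1 : Set.range Xᵀ = S.subtype '' Set.range b := by
      rw [← Set.range_comp]
      rfl
    rw [h1, ← Submodule.map_span, b.span_eq, Submodule.map_top, Submodule.range_subtype]
  obtain ⟨Y, hY⟩ := exists_mul_of_span_le (A := P) (B := X) (by rw [hX, hS])
  obtain ⟨Z, hZ⟩ := exists_mul_of_span_le (A := X) (B := P) (by rw [hX, hS])
  have hinj : ∀ C : Matrix (Fin (Module.finrank (ℍ[ℝ])ᵐᵒᵖ S))
      (Fin (Module.finrank (ℍ[ℝ])ᵐᵒᵖ S)) ℍ[ℝ], X * C = 0 → C = 0 := by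
    intro C hC
    ext1 l j
    have h2 : ∑ l, MulOpposite.op (C l j) • b l = 0 := by
      apply Subtype.ext
      ext1 i
      have := congrFun (congrFun hC i) j
      simpa [Matrix.mul_apply, X, Finset.sum_apply] using this
    have := Fintype.linearIndependent_iff.1 b.linearIndependent _ h2 l
    simpa using this
  have hYX : Y * X = 1 := by
    rw [← sub_eq_zero]
    apply hinj
    rw [Matrix.mul_sub, Matrix.mul_one, ← Matrix.mul_assoc, ← hY, sub_eq_zero, hZ,
      ← Matrix.mul_assoc, hP]
  rw [hr]
  conv_lhs => rw [hY, re_trace_mul_comm, hYX]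
  simp [Matrix.trace]

/-- If `N = X * M ^ (k + 1)` and `X * M ^ (k + 2) = 0`, then `N * Nᴴ = X * M ^ (2 * k + 2) * Xᴴ =
0`, so `N = 0` and the exponent descends to one. -/
theorem mul_eq_zero_of_mul_pow_eq_zero {m n : ℕ} {M : Matrix (Fin n) (Fin n) ℍ[ℝ]}
    (hM : M.IsHermitian) {X : Matrix (Fin m) (Fin n) ℍ[ℝ]} {k : ℕ} (h : X * M ^ k = 0) :
    X * M = 0 := by
  have key : ∀ k, X * M ^ (k + 1) = 0 → X * M = 0 := by
    intro k
    induction k with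
    | zero => intro h; simpa using h
    | succ k ih =>
      intro h
      refine ih ?_
      rw [← Matrix.conjTranspose_eq_zero]
      apply eq_zero_of_conjTranspose_mul_self
      rw [Matrix.conjTranspose_conjTranspose, Matrix.conjTranspose_mul, Matrix.conjTranspose_pow,
        hM.eq, ← Matrix.mul_assoc, Matrix.mul_assoc X, ← pow_add,
        show k + 1 + (k + 1) = k + 1 + 1 + k by omega, pow_add, ← Matrix.mul_assoc X, h,
        Matrix.zero_mul, Matrix.zero_mul]
  refine key k ?_
  rw [pow_succ, ← Matrix.mul_assoc, h, Matrix.zero_mul]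

/-! ### The Faddeev-LeVerrier recursion for sums of cofactors -/

section Faddeev

variable {n : ℕ}

/-- The matrix of the sums of the cofactors of order `k`. -/
noncomputable def adjSum (k : ℕ) (M : Matrix (Fin n) (Fin n) ℍ[ℝ]) :
    Matrix (Fin n) (Fin n) ℍ[ℝ] :=
  Matrix.of fun i q => ∑ β with β.card = k ∧ i ∈ β, if q ∈ β then cofactor M β i q else 0

theorem adjSum_mul_apply {p : ℕ} (k : ℕ) (M : Matrix (Fin n) (Fin n) ℍ[ℝ])
    (B : Matrix (Fin n) (Fin p) ℍ[ℝ]) (i : Fin n) (j : Fin p) :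
    (adjSum k M * B) i j =
      ∑ β with β.card = k ∧ i ∈ β, ∑ q ∈ β, cofactor M β i q * B q j := by
  simp only [Matrix.mul_apply, adjSum, Matrix.of_apply, Finset.sum_mul]
  rw [Finset.sum_comm]
  refine Finset.sum_congr rfl fun β _ => ?_
  simp only [ite_mul, zero_mul]
  rw [Finset.sum_ite_mem, Finset.univ_inter]

theorem cdetSum_eq_adjSum_mul {p : ℕ} (k : ℕ) (M : Matrix (Fin n) (Fin n) ℍ[ℝ])
    (B : Matrix (Fin n) (Fin p) ℍ[ℝ]) : cdetSum k M B = adjSum k M * B := by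
  ext1 i j
  rw [adjSum_mul_apply, cdetSum, Matrix.of_apply]
  rw [Finset.sum_subtype (p := fun β : Finset (Fin n) => β.card = k ∧ i ∈ β) _ (by simp)]
  exact Finset.sum_congr rfl fun β _ =>
    cdet_principal_updateCol M β.1 ⟨i, β.2.2⟩ fun l => B l j

theorem minorSum_eq_sum (k : ℕ) (M : Matrix (Fin n) (Fin n) ℍ[ℝ]) :
    minorSum k M = ∑ β with β.card = k, minorOn M β := by
  rw [minorSum, Finset.sum_subtype (p := fun β : Finset (Fin n) => β.card = k) _ (by simp)]
  exact Finset.sum_congr rfl fun β _ => principalMinor_eq_minorOn M β.1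

theorem sum_notMem_eq_sum_mem (k : ℕ) (s : Fin n) (f : Finset (Fin n) → ℍ[ℝ]) :
    ∑ β : Finset (Fin n) with β.card = k ∧ s ∉ β, f β =
      ∑ γ : Finset (Fin n) with γ.card = k + 1 ∧ s ∈ γ, f (γ.erase s) := by
  refine Finset.sum_bij' (fun β _ => insert s β) (fun γ _ => γ.erase s) ?_ ?_ ?_ ?_ ?_
  · intro β hβ
    simp only [Finset.mem_filter, Finset.mem_univ, true_and] at hβ ⊢
    exact ⟨by rw [Finset.card_insert_of_notMem hβ.2, hβ.1], Finset.mem_insert_self _ _⟩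
  · intro γ hγ
    simp only [Finset.mem_filter, Finset.mem_univ, true_and] at hγ ⊢
    exact ⟨by rw [Finset.card_erase_of_mem hγ.2, hγ.1, Nat.add_sub_cancel],
      Finset.notMem_erase _ _⟩
  · intro β hβ
    simp only [Finset.mem_filter] at hβ
    exact Finset.erase_insert hβ.2.2
  · intro γ hγ
    simp only [Finset.mem_filter] at hγ
    exact Finset.insert_erase hγ.2.2
  · intro β hβ
    simp only [Finset.mem_filter] at hβ
    rw [Finset.erase_insert hβ.2.2]

theorem adjSum_succ_apply_self (k : ℕ) (M : Matrix (Fin n) (Fin n) ℍ[ℝ]) (i : Fin n) :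
    adjSum (k + 1) M i i = ∑ β with β.card = k ∧ i ∉ β, minorOn M β := by
  rw [sum_notMem_eq_sum_mem, adjSum, Matrix.of_apply]
  refine Finset.sum_congr rfl fun γ hγ => ?_
  rw [Finset.mem_filter] at hγ
  rw [if_pos hγ.2.2, cofactor_self]

/-- On the diagonal, the sets containing `i` contribute their minors through the product, and those
missing `i` through the next order. Off the diagonal, the sets containing `s` contribute zero by
orthogonality, and each set `β` missing `s` cancels against the cofactor on `insert s β` by
`cofactor_of_ne`. -/
theorem adjSum_mul_self_add (k : ℕ) {M : Matrix (Fin n) (Fin n) ℍ[ℝ]} (hM : M.IsHermitian)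
    (i s : Fin n) :
    (adjSum k M * M) i s + adjSum (k + 1) M i s = if i = s then minorSum k M else 0 := by
  rw [adjSum_mul_apply]
  split_ifs with his
  · subst his
    rw [adjSum_succ_apply_self, minorSum_eq_sum,
      ← Finset.sum_filter_add_sum_filter_not ({β : Finset (Fin n) | β.card = k} : Finset _)
        (fun β : Finset (Fin n) => i ∈ β), Finset.filter_filter, Finset.filter_filter]
    congr 1
    refine Finset.sum_congr rfl fun β hβ => ?_
    rw [Finset.mem_filter] at hβ
    rw [(cofactorSpec β M hM).sum_mul i hβ.2.2 i hβ.2.2, if_pos rfl]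
  · have h1 : adjSum (k + 1) M i s =
        ∑ β : Finset (Fin n) with β.card = k ∧ s ∉ β,
          if i ∈ β then cofactor M (insert s β) i s else 0 := by
      rw [sum_notMem_eq_sum_mem, adjSum, Matrix.of_apply, ← Finset.filter_filter,
        ← Finset.filter_filter, Finset.sum_filter, Finset.sum_filter (fun γ : Finset (Fin n) => s ∈ γ)]
      refine Finset.sum_congr rfl fun γ _ => ?_
      by_cases hi : i ∈ γ <;> by_cases hs : s ∈ γ <;>
        simp [hi, hs, his, Finset.insert_erase]
    rw [h1, ← Finset.filter_filter, ← Finset.filter_filter, Finset.sum_filter,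
      Finset.sum_filter (fun β : Finset (Fin n) => s ∉ β), ← Finset.sum_add_distrib]
    refine Finset.sum_eq_zero fun β _ => ?_
    by_cases hi : i ∈ β
    · by_cases hs : s ∈ β
      · simp [hi, hs, (cofactorSpec β M hM).sum_mul i hi s hs, his]
      · rw [if_pos hi, if_pos hs, if_pos hi, cofactor_of_ne M (Finset.mem_insert_of_mem hi)
          (Finset.mem_insert_self s β) his, Finset.erase_insert hs, add_neg_cancel]
    · simp [hi]

theorem star_minorSum (k : ℕ) {M : Matrix (Fin n) (Fin n) ℍ[ℝ]} (hM : M.IsHermitian) :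
    star (minorSum k M) = minorSum k M := by
  rw [minorSum_eq_sum, star_sum]
  exact Finset.sum_congr rfl fun β _ => (cofactorSpec β M hM).star_minorOn

theorem minorSum_eq_coe_re (k : ℕ) {M : Matrix (Fin n) (Fin n) ℍ[ℝ]} (hM : M.IsHermitian) :
    minorSum k M = ((minorSum k M).re : ℝ) :=
  Quaternion.star_eq_self.1 (star_minorSum k hM)

/-- The Faddeev-LeVerrier recursion. -/
theorem adjSum_mul_add_adjSum_succ (k : ℕ) {M : Matrix (Fin n) (Fin n) ℍ[ℝ]}
    (hM : M.IsHermitian) :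
    adjSum k M * M + adjSum (k + 1) M = (minorSum k M).re • (1 : Matrix (Fin n) (Fin n) ℍ[ℝ]) := by
  ext1 i s
  rw [Matrix.add_apply, adjSum_mul_self_add k hM, Matrix.smul_apply, Matrix.one_apply]
  split_ifs
  · rw [← Algebra.algebraMap_eq_smul_one]
    exact minorSum_eq_coe_re k hM
  · rw [smul_zero]

/-- Each `k`-element set is missed by exactly `n - k` indices. -/
theorem trace_adjSum_succ (k : ℕ) (M : Matrix (Fin n) (Fin n) ℍ[ℝ]) :
    (adjSum (k + 1) M).trace = ((n : ℝ) - k) • minorSum k M := by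
  simp only [Matrix.trace, Matrix.diag_apply, adjSum_succ_apply_self]
  simp only [← Finset.filter_filter, Finset.sum_filter (fun β => _ ∉ β)]
  rw [Finset.sum_comm, minorSum_eq_sum, Finset.smul_sum]
  refine Finset.sum_congr rfl fun β hβ => ?_
  rw [Finset.mem_filter] at hβ
  rw [← Finset.sum_filter, Finset.sum_const, Finset.filter_not, Finset.filter_mem_eq_inter,
    Finset.univ_inter, ← Finset.compl_eq_univ_sdiff, Finset.card_compl, Fintype.card_fin, hβ.2,
    ← Nat.cast_smul_eq_nsmul ℝ, Nat.cast_sub]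
  rw [← hβ.2]
  simpa using Finset.card_le_univ β

theorem adjSum_card_succ (M : Matrix (Fin n) (Fin n) ℍ[ℝ]) : adjSum (n + 1) M = 0 := by
  ext1 i s
  rw [adjSum, Matrix.of_apply, Finset.filter_false_of_mem, Finset.sum_empty, Matrix.zero_apply]
  intro β _ h
  have := Finset.card_le_univ β
  rw [Fintype.card_fin] at this
  omega

theorem minorSum_zero (M : Matrix (Fin n) (Fin n) ℍ[ℝ]) : minorSum 0 M = 1 := by
  rw [minorSum_eq_sum]
  simp [Finset.filter_eq', minorOn_empty]

/-- The sum of the principal minors of order `rank M` of a Hermitian matrix does not vanish, and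
the matrix of the sums of cofactors of this order is a multiple of a generalized inverse. -/
theorem minorSum_rank {M : Matrix (Fin n) (Fin n) ℍ[ℝ]} (hM : M.IsHermitian) :
    (minorSum (rank M) M).re ≠ 0 ∧
      adjSum (rank M) M * (M * M) = (minorSum (rank M) M).re • M := by
  obtain ⟨d, hd⟩ : ∃ d : ℕ → ℝ, d = fun k => (minorSum k M).re := ⟨_, rfl⟩
  have hrec : ∀ k, adjSum k M * M + adjSum (k + 1) M =
      d k • (1 : Matrix (Fin n) (Fin n) ℍ[ℝ]) := fun k => by
    rw [hd]; exact adjSum_mul_add_adjSum_succ k hM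
  classical
  -- The largest order with nonzero minor sum; it exists since `d 0 = 1`, and is identified with the
  -- rank by a trace count below.
  obtain ⟨a, ha⟩ : ∃ a, a = Nat.findGreatest (fun k => d k ≠ 0) n := ⟨_, rfl⟩
  have han : a ≤ n := ha ▸ Nat.findGreatest_le n
  have hda : d a ≠ 0 := by
    rw [ha]
    refine Nat.findGreatest_spec (P := fun k => d k ≠ 0) (Nat.zero_le n) ?_
    simp [hd, minorSum_zero]
  have hgt : ∀ k, a < k → k ≤ n → d k = 0 := fun k h1 h2 => by
    by_contra h
    exact Nat.findGreatest_is_greatest (ha ▸ h1) h2 h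
  have hpow : ∀ j, a + j ≤ n →
      adjSum (a + j + 1) M = (-1 : ℝ) ^ j • (adjSum (a + 1) M * M ^ j) := by
    intro j
    induction j with
    | zero => intro _; simp
    | succ j ih =>
      intro hj
      have h1 := hrec (a + (j + 1))
      rw [hgt _ (by omega) hj, zero_smul, ← eq_neg_iff_add_eq_zero.trans Iff.rfl] at h1
      have h2 : adjSum (a + (j + 1) + 1) M = -(adjSum (a + (j + 1)) M * M) := by
        rw [h1, neg_neg]
      rw [h2, show a + (j + 1) = a + j + 1 by omega, ih (by omega), pow_succ M,
        ← Matrix.mul_assoc, Matrix.smul_mul, pow_succ, mul_neg_one, neg_smul]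
  -- There are no cofactors of order `n + 1`, so `adjSum (a + 1) M` is annihilated by a power of
  -- `M`, hence by `M` itself.
  have h0 : adjSum (a + 1) M * M = 0 := by
    have h1 := hpow (n - a) (by omega)
    rw [show a + (n - a) = n by omega, adjSum_card_succ, eq_comm,
      smul_eq_zero_iff_right (pow_ne_zero _ (by norm_num))] at h1
    exact mul_eq_zero_of_mul_pow_eq_zero hM h1
  have hMM : adjSum a M * (M * M) = d a • M := by
    have h1 := congrArg (· * M) (hrec a)
    simp only [Matrix.add_mul, h0, add_zero, Matrix.smul_mul, Matrix.one_mul] at h1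
    rw [← Matrix.mul_assoc, h1]
  obtain ⟨X, hX⟩ := exists_isMoorePenrose M
  have hMMX : M = M * M * X := by
    have h1 := congrArg Matrix.conjTranspose hX.mul_mul_left
    rw [Matrix.conjTranspose_mul, hX.left_hermitian, hM.eq, ← Matrix.mul_assoc] at h1
    exact h1.symm
  have hP : adjSum a M * M = d a • (M * X) := by
    rw [← Matrix.smul_mul, ← hMM, Matrix.mul_assoc, ← hMMX]
  have hrank : rank (M * X) = rank M := by
    refine le_antisymm (rank_mul_le _ _) ?_
    conv_lhs => rw [← hX.mul_mul_left]
    exact rank_mul_le _ _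
  have htr : (M * X).trace.re = rank M := by
    rw [← hrank]
    exact re_trace_of_isIdempotentElem (by rw [← Matrix.mul_assoc, hX.mul_mul_left])
  -- Real traces in the recursion at order `a` give `d a * rank M + (n - a) * d a = n * d a`.
  have har : a = rank M := by
    have h1 := congrArg (fun Z => Z.trace.re) (hrec a)
    simp only [hP, Matrix.trace_add, Matrix.trace_smul, trace_adjSum_succ, Quaternion.re_add,
      Quaternion.re_smul, htr, Matrix.trace_one, Fintype.card_fin] at h1
    have h2 : (minorSum a M).re = d a := by rw [hd]
    rw [h2] at h1
    have h3 : d a * ((rank M : ℝ) - a) = 0 := by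
      simp at h1
      linarith
    rcases mul_eq_zero.1 h3 with h | h
    · exact absurd h hda
    · exact_mod_cast (sub_eq_zero.1 h).symm
  rw [← har]
  have h2 : (minorSum a M).re = d a := by rw [hd]
  rw [h2]
  exact ⟨hda, hMM⟩

end Faddeev

/-! ### Determinantal representations of generalized inverses -/

theorem mpInv_spec {m n : ℕ} (A : Matrix (Fin m) (Fin n) ℍ[ℝ]) : IsMoorePenrose A (mpInv A) :=
  (exists_isMoorePenrose A).choose_spec

theorem wDrazinInv_spec {m n : ℕ} (A : Matrix (Fin m) (Fin n) ℍ[ℝ])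
    (W : Matrix (Fin n) (Fin m) ℍ[ℝ]) : IsWeightedDrazin A W (wDrazinInv A W) :=
  (exists_isWeightedDrazin A W).choose_spec

theorem rank_conjTranspose_mul_self {m n : ℕ} (A : Matrix (Fin m) (Fin n) ℍ[ℝ]) :
    rank (Aᴴ * A) = rank A := by
  refine le_antisymm (rank_mul_le_right _ _) ?_
  have h := mpInv_spec A
  have h1 : A = (mpInv A)ᴴ * (Aᴴ * A) := by
    rw [← Matrix.mul_assoc, ← Matrix.conjTranspose_mul, h.left_hermitian, h.mul_mul_left]
  conv_lhs => rw [h1]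
  exact rank_mul_le_right _ _

theorem cdetSum_mul_mul {n p : ℕ} {M : Matrix (Fin n) (Fin n) ℍ[ℝ]} (hM : M.IsHermitian)
    (Y : Matrix (Fin n) (Fin p) ℍ[ℝ]) :
    cdetSum (rank M) M (M * (M * Y)) = (minorSum (rank M) M).re • (M * Y) := by
  rw [cdetSum_eq_adjSum_mul, ← Matrix.mul_assoc M, ← Matrix.mul_assoc, (minorSum_rank hM).2,
    Matrix.smul_mul]

/-- Cramer's rule for the Moore-Penrose inverse. -/
theorem cdetSum_conjTranspose_mul {m n p : ℕ} (B : Matrix (Fin m) (Fin n) ℍ[ℝ])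
    (C : Matrix (Fin m) (Fin p) ℍ[ℝ]) :
    cdetSum (rank B) (Bᴴ * B) (Bᴴ * C) = (minorSum (rank B) (Bᴴ * B)).re • (mpInv B * C) := by
  have h := mpInv_spec B
  have h1 : Bᴴ * B * mpInv B = Bᴴ := by
    have := congrArg Matrix.conjTranspose h.mul_mul_left
    rwa [Matrix.conjTranspose_mul, h.left_hermitian, ← Matrix.mul_assoc] at this
  -- With `Y = B† (B†)ᴴ B† C` and `M = Bᴴ * B`, one gets `M * Y = B† C` and `M * (M * Y) = Bᴴ * C`,
  -- the shape required by `cdetSum_mul_mul`.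
  have h2 : Bᴴ * B * (mpInv B * (mpInv B)ᴴ * mpInv B) = mpInv B := by
    rw [← Matrix.mul_assoc, ← Matrix.mul_assoc, h1, ← Matrix.conjTranspose_mul, h.right_hermitian,
      h.mul_mul_right]
  have h3 := cdetSum_mul_mul (Matrix.isHermitian_conjTranspose_mul_self B)
    (mpInv B * (mpInv B)ᴴ * mpInv B * C)
  rw [rank_conjTranspose_mul_self] at h3
  rw [← Matrix.mul_assoc _ _ C, h2, ← Matrix.mul_assoc _ _ C, h1] at h3
  exact h3

theorem minorSum_conjTranspose_mul_self {m n : ℕ} (B : Matrix (Fin m) (Fin n) ℍ[ℝ]) :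
    ∃ c : ℝ, c ≠ 0 ∧ minorSum (rank B) (Bᴴ * B) = c ∧
      ∀ {p : ℕ} (C : Matrix (Fin m) (Fin p) ℍ[ℝ]),
        cdetSum (rank B) (Bᴴ * B) (Bᴴ * C) = c • (mpInv B * C) := by
  have hH := Matrix.isHermitian_conjTranspose_mul_self B
  have h := (minorSum_rank hH).1
  rw [rank_conjTranspose_mul_self] at h
  exact ⟨_, h, minorSum_eq_coe_re _ hH, fun C => cdetSum_conjTranspose_mul B C⟩

/-! ### Drazin inverses -/

section Drazin

variable {R : Type*} [Ring R] {v d : R} {k : ℕ}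

theorem pow_add_mul_pow_of_drazin (h : v ^ (k + 1) * d = v ^ k) (j : ℕ) :
    v ^ (k + j) * d ^ j = v ^ k :=
  (pow_eq_pow_add_mul_pow h.symm j).symm

theorem pow_succ_mul_of_le {p : ℕ} (hpk : p ≤ k) (h : v ^ (p + 1) * d = v ^ p) :
    v ^ (k + 1) * d = v ^ k := by
  obtain ⟨j, rfl⟩ := Nat.exists_eq_add_of_le' hpk
  rw [add_assoc, pow_add, mul_assoc, h, ← pow_add]

theorem pow_mul_pow_succ_of_drazin (hc : Commute v d) (hd : d * v * d = d) (j : ℕ) :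
    v ^ j * d ^ (j + 1) = d := by
  induction j with
  | zero => simp
  | succ j ih =>
    calc v ^ (j + 1) * d ^ (j + 1 + 1) = v * (v ^ j * d ^ (j + 1)) * d := by
          rw [pow_succ', pow_succ d (j + 1), mul_assoc, mul_assoc, mul_assoc]
      _ = d := by rw [ih, hc.eq, hd]

/-- `v ^ k * x * v ^ k` is the Drazin inverse of `v` for every inner inverse `x` of
`v ^ (2 * k + 1)`. -/
theorem pow_mul_mul_pow_eq_drazin (hc : Commute v d) (hd : d * v * d = d)
    (h : v ^ (k + 1) * d = v ^ k) {x : R} (hx : v ^ (2 * k + 1) * x * v ^ (2 * k + 1) =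
      v ^ (2 * k + 1)) : v ^ k * x * v ^ k = d := by
  have h1 : v ^ (2 * k + 1) * d ^ (k + 1) = v ^ k := by
    rw [← pow_add_mul_pow_of_drazin h (k + 1)]
    congr 2
    omega
  have h2 : d ^ (k + 1) * v ^ (2 * k + 1) = v ^ k := by
    rw [← (hc.pow_pow _ _).eq, h1]
  calc v ^ k * x * v ^ k
      = d ^ (k + 1) * (v ^ (2 * k + 1) * x * v ^ (2 * k + 1)) * d ^ (k + 1) := by
        conv_lhs => rw [← h1]
        conv_lhs => enter [1, 1]; rw [h1, ← h2]
        simp only [mul_assoc]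
    _ = v ^ k * d ^ (k + 1) := by rw [hx, h2]
    _ = d := pow_mul_pow_succ_of_drazin hc hd k

end Drazin

/-! ### Assembling the two formulas. -/

theorem wmpdInv_eq {m n : ℕ} (A : Matrix (Fin m) (Fin n) ℍ[ℝ])
    (W : Matrix (Fin n) (Fin m) ℍ[ℝ]) :
    wmpdInv A W = mpInv A * (A * W * (wDrazinInv A W * W)) := by
  simp only [wmpdInv, Matrix.mul_assoc]

theorem rank_pow_eq {n : ℕ} {V D : Matrix (Fin n) (Fin n) ℍ[ℝ]} {k : ℕ}
    (h : V ^ (k + 1) * D = V ^ k) (j : ℕ) : rank (V ^ (k + j)) = rank (V ^ k) := by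
  refine le_antisymm ?_ ?_
  · rw [pow_add]
    exact rank_mul_le _ _
  · conv_lhs => rw [← pow_add_mul_pow_of_drazin h j]
    exact rank_mul_le _ _

end QMat

theorem theorem4p6 {m n : ℕ} (A : Matrix (Fin m) (Fin n) ℍ[ℝ]) (W : Matrix (Fin n) (Fin m) ℍ[ℝ])
    (hW : W ≠ 0) (r r₁ k : ℕ) (hr : QMat.rank A = r)
    (hk : k = max (QMat.index (W * A)) (QMat.index (A * W)))
    (hr₁ : QMat.rank ((A * W) ^ k) = r₁) :
    -- (i) `A * W` arbitrary
    (∀ V M Ψ Υ : Matrix (Fin m) (Fin m) ℍ[ℝ],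
      V = A * W →
      M = (V ^ (2 * k + 1))ᴴ * V ^ (2 * k + 1) →
      Ψ = QMat.cdetSum r₁ M ((V ^ (2 * k + 1))ᴴ * V ^ k) →
      Υ = QMat.cdetSum r₁ M ((V ^ (2 * k + 1))ᴴ * V ^ (2 * k) * Ψ * A * W) →
      ∀ i j, QMat.wmpdInv A W i j =
        QMat.cdetSum r (Aᴴ * A) (Aᴴ * (A * W) ^ (k + 1) * Υ) i j /
          (QMat.minorSum r (Aᴴ * A) * QMat.minorSum r₁ M ^ 2)) ∧
    -- (ii) `A * W` Hermitian
    ((A * W).IsHermitian → ∀ Υ : Matrix (Fin m) (Fin m) ℍ[ℝ],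
      Υ = QMat.cdetSum r₁ ((A * W) ^ (k + 2)) ((A * W) ^ (k + 1)) →
      ∀ i j, QMat.wmpdInv A W i j =
        QMat.cdetSum r (Aᴴ * A) (Aᴴ * A * W * Υ) i j /
          (QMat.minorSum r (Aᴴ * A) * QMat.minorSum r₁ ((A * W) ^ (k + 2)))) := by
  obtain ⟨D, hD⟩ : ∃ D, D = QMat.wDrazinInv A W * W := ⟨_, rfl⟩
  have hspec := QMat.wDrazinInv_spec A W
  have hcomm : Commute (A * W) D := by
    rw [hD]
    change A * W * _ = _
    rw [← Matrix.mul_assoc, hspec.comm, Matrix.mul_assoc (QMat.wDrazinInv A W * W)]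
  have hDVD : D * (A * W) * D = D := by
    rw [hD, ← Matrix.mul_assoc (_ * W) A W, ← Matrix.mul_assoc _ _ W, hspec.mul_mul]
  have hpow : (A * W) ^ (k + 1) * D = (A * W) ^ k := by
    refine QMat.pow_succ_mul_of_le (p := QMat.index (A * W)) (hk ▸ le_max_right _ _) ?_
    rw [hD]
    exact (Matrix.mul_assoc _ _ _).symm.trans hspec.pow_mul
  have hwmpd := QMat.wmpdInv_eq A W
  rw [← hD] at hwmpd
  obtain ⟨a, ha0, ha, haC⟩ := QMat.minorSum_conjTranspose_mul_self A
  rw [hr] at ha haC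
  constructor
  · rintro V M Ψ Υ rfl hM hΨ hΥ i j
    obtain ⟨c, hc0, hc, hcC⟩ := QMat.minorSum_conjTranspose_mul_self ((A * W) ^ (2 * k + 1))
    have hrk : QMat.rank ((A * W) ^ (2 * k + 1)) = r₁ := by
      rw [show 2 * k + 1 = k + (k + 1) by omega, QMat.rank_pow_eq hpow, hr₁]
    rw [hrk, ← hM] at hc hcC
    rw [hcC] at hΨ
    have hdr := QMat.pow_mul_mul_pow_eq_drazin hcomm hDVD hpow
      (QMat.mpInv_spec ((A * W) ^ (2 * k + 1))).mul_mul_left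
    generalize QMat.mpInv ((A * W) ^ (2 * k + 1)) = X at *
    -- One factor `c` comes from `Ψ` and one from `Υ`; this is the squared minor sum in the
    -- denominator.
    have hΥ' : (A * W) ^ (k + 1) * Υ = c ^ 2 • (A * W * D) := by
      have e1 : ((A * W) ^ (2 * k + 1))ᴴ * (A * W) ^ (2 * k) * Ψ * A * W =
          ((A * W) ^ (2 * k + 1))ᴴ * ((A * W) ^ (2 * k) * Ψ * (A * W)) := by
        simp only [Matrix.mul_assoc]
      rw [hΥ, e1, hcC, hΨ]
      generalize A * W = V at *
      simp only [Matrix.mul_smul, Matrix.smul_mul, smul_smul, ← pow_two]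
      congr 1
      calc V ^ (k + 1) * (X * (V ^ (2 * k) * (X * V ^ k) * V))
          = V * (V ^ k * X * V ^ k) * (V ^ k * X * V ^ k) * V := by
            rw [two_mul, pow_add V k k, pow_succ' V k]
            simp only [mul_assoc]
        _ = V * D := by
            rw [hdr, mul_assoc, ← hcomm.eq, mul_assoc, ← mul_assoc D, hDVD]
    rw [Matrix.mul_assoc, hΥ', haC, Matrix.mul_smul, smul_smul, ← hwmpd, ha, hc,
      ← Quaternion.coe_pow, ← Quaternion.coe_mul, Matrix.smul_apply,
      ← Quaternion.mul_coe_eq_smul, mul_div_cancel_right₀]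
    exact (map_ne_zero (algebraMap ℝ ℍ[ℝ])).2 (mul_ne_zero ha0 (pow_ne_zero 2 hc0))
  · intro hV Υ hΥ i j
    have hM : ((A * W) ^ (k + 2)).IsHermitian := hV.pow _
    have hrk : QMat.rank ((A * W) ^ (k + 2)) = r₁ := by rw [QMat.rank_pow_eq hpow, hr₁]
    have hc0 := (QMat.minorSum_rank hM).1
    have hc := QMat.minorSum_eq_coe_re r₁ hM
    -- The exponent makes `V ^ (k + 2) * D ^ (k + 3) = D`, so multiplying by `V ^ (k + 2)` once more
    -- gives the prescribed columns `V ^ (k + 1)`, and `Υ` is a real multiple of `D`.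
    have hY := QMat.cdetSum_mul_mul hM (D ^ (k + 3))
    rw [hrk] at hc0 hY
    have e1 : (A * W) ^ (k + 2) * D ^ (k + 3) = D :=
      QMat.pow_mul_pow_succ_of_drazin hcomm hDVD (k + 2)
    have e2 : (A * W) ^ (k + 2) * D = (A * W) ^ (k + 1) :=
      QMat.pow_succ_mul_of_le (Nat.le_succ k) hpow
    rw [e1, e2, ← hΥ] at hY
    generalize (QMat.minorSum r₁ ((A * W) ^ (k + 2))).re = c at *
    rw [Matrix.mul_assoc Aᴴ A W, Matrix.mul_assoc, hY, Matrix.mul_smul, haC, Matrix.mul_smul,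
      smul_smul, ← hwmpd, ha, hc, ← Quaternion.coe_mul, Matrix.smul_apply,
      ← Quaternion.mul_coe_eq_smul, mul_comm a, mul_div_cancel_right₀]
    exact (map_ne_zero (algebraMap ℝ ℍ[ℝ])).2 (mul_ne_zero hc0 ha0)
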